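/- **Rational solution of Q2.** Let $p,q,a,c\in\mathbb C$ be non-zero with $p^2\ne a^2$, $q^2\ne a^2$, let $N\in\mathbb N$, and let $\mathcal A_+,\mathcal A_-$ be non-singular lower triangular $N\times N$ Toeplitz matrices. For $n,m\in\mathbb Z$ put $$\phi^\pm_s(\alpha,\beta,l)=\frac1{(2s)!}\,\partial_k^{2s}\Big[(p\pm k)^n(q\pm k)^m(a\pm k)^\alpha(b\pm k)^\beta(c\pm k)^{l+\frac12}\Big]\Big|_{k=0},\qquad s=0,\dots,N-1,$$ where $(c+k)^{l+1/2}=c^{l+1/2}(1+k/c)^{l+1/2}$ with principal powers, $\Phi(\alpha,\beta,l)=\mathcal A_+(\phi^+_s)_s+\mathcal A_-(\phi^-_s)_s$, and $$f=|\Phi(0,0,0),\dots,\Phi(0,0,N-1)|,\qquad S(a,b)=-\frac{(ab)^N|\Phi(-1,-1,0),\dots,\Phi(-1,-1,N-1)|-f}{(a+b)\,f},$$ where $S(a,-a):=\lim_{b\to -a}S(a,b)$. (The function $f=f_{n,m}$ depends on neither $a$ nor $b$; $S(a,b)$ is the rational solution of the NQC equation, and $S(\pm a,\pm b)$ denotes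 the same function with the parameters changed accordingly.) Put $$\xi=2a\Big(\frac{p}{a^2-p^2}n+\frac{q}{a^2-q^2}m\Big),\qquad \rho(a)=\Big(\frac{p+a}{p-a}\Big)^n\Big(\frac{q+a}{q-a}\Big)^m,$$ $$U(a,-a)=-\frac1{2a}\,\partial_\epsilon S(a,2a\epsilon-a)\big|_{\epsilon=0},\qquad U(-a,a)=\frac1{2a}\,\partial_\epsilon S(-a,a-2a\epsilon)\big|_{\epsilon=0},$$ and, for arbitrary constants $\xi_0,A,D\in\mathbb C$, $$u=\tfrac14\big((\xi+\xi_0)^2+1\big)+a(\xi+\xi_0)S(-a,a)+a^2\big(U(a,-a)+U(-a,a)\big)+AD+\tfrac12A\rho(a)\big(1-2aS(a,a)\big)+\tfrac12D\rho(-a)\big(1+2aS(-a,-a)\big).$$ Then: 1. At every $(n,m)$ with $f_{n,m}\neq0$ the derivatives defining $U(a,-a)$ and $U(-a,a)$ exist. 2. (Degeneration.) Let $\delta\neq 0$, $b=a(1-2\epsilon)$, $P^2=(p^2-a^2)(p^2-b^2)$, $Q^2=(q^2-a^2)(q^2-b^2)$ with $P\to p^2-a^2$, $Q\to q^2-a^2$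 as $\epsilon\to0$, let $\digamma(a,b)=\big(\frac{P}{(p-a)(p-b)}\big)^n\big(\frac{Q}{(q-a)(q-b)}\big)^m$, and let $$u^{Q3}=A'\digamma(a,b)[1-(a+b)S(a,b)]+B'\digamma(a,-b)[1-(a-b)S(a,-b)]+C'\digamma(-a,b)[1+(a-b)S(-a,b)]+D'\digamma(-a,-b)[1+(a+b)S(-a,-b)]$$ be the expression for the rational solution of Q3$_\delta$ with the constants replaced by $$A'=\tfrac{\delta}{4a^2}A\epsilon,\quad D'=\tfrac{\delta}{4a^2}D\epsilon,\quad B'=\tfrac{\delta}{8a^2}\Big(\tfrac1\epsilon+1-\xi_0+\big(\tfrac{3+\xi_0^2}2+2AD\big)\epsilon\Big),\quad C'=\tfrac{\delta}{8a^2}\Big(\tfrac1\epsilon+1+\xi_0+\big(\tfrac{3+\xi_0^2}2+2AD\big)\epsilon\Big).$$ If, for small $\epsilon\ne0$, $u^{Q3}=\frac{\delta}{4a^2}\big(\frac1\epsilon+1+(1+2v(\epsilon))\epsilon\big)$, then $v(\epsilon)\to u$ as $\epsilon\to0$ at every $(n,m)$ with $f_{n,m}\ne0$. 3. (Rationality.)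 There are polynomials $F,G_0,G_1,G_2$ in $(n,m)$ such that $f=(p^nq^m)^NF$ for all $n,m\in\mathbb Z$, and $u=\big(G_0+A\rho(a)G_1+D\rho(-a)G_2\big)/F$ at every $(n,m)$ with $f_{n,m}\neq 0$. 4. (Solution of Q2.) At every $(n,m)$ for which $f$ does not vanish at the four points $(n,m),(n+1,m),(n,m+1),(n+1,m+1)$, with $\widetilde u=u_{n+1,m}$, $\widehat u=u_{n,m+1}$, $\widehat{\widetilde u}=u_{n+1,m+1}$, the function $u$ satisfies Q2, $$p'(u-\widehat u)(\widetilde u-\widehat{\widetilde u})-q'(u-\widetilde u)(\widehat u-\widehat{\widetilde u})+p'q'(p'-q')(u+\widetilde u+\widehat u+\widehat{\widetilde u})=p'q'(p'-q')(p'^2-p'q'+q'^2)$$ with $p'=\frac{a^2}{p^2-a^2}$, $q'=\frac{a^2}{q^2-a^2}$; equivalently, $w=a^{-4}(p^2-a^2)^2(q^2-a^2)^2u$ satisfies the re-parametrized equation $$(q^2-a^2)(w-\widehat w)(\widetilde w-\widehat{\widetilde w})-(p^2-a^2)(w-\widetilde w)(\widehat w-\widehat{\widetilde w})+\kappa(w+\widetilde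 w+\widehat w+\widehat{\widetilde w})=\kappa\big((p^2-a^2)^2+(q^2-a^2)^2-(p^2-a^2)(q^2-a^2)\big),$$ $\kappa=(p^2-a^2)(q^2-a^2)(q^2-p^2)$. -/

import Mathlib

open Filter Topology

noncomputable section

/-- The quad equation Q2 with lattice parameters `p'`, `q'`; the arguments are the values
`u = u(n,m)`, `ut = u(n+1,m)`, `uh = u(n,m+1)`, `uth = u(n+1,m+1)` on an elementary square. -/
def Q2Eq (p' q' u ut uh uth : ℂ) : Prop :=
  p' * (u - uh) * (ut - uth) - q' * (u - ut) * (uh - uth)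
      + p' * q' * (p' - q') * (u + ut + uh + uth)
    = p' * q' * (p' - q') * (p' ^ 2 - p' * q' + q' ^ 2)

/-- The re-parametrized equation Q2, in terms of the parameters `p`, `q`, `a`. -/
def Q2ParamEq (p q a u ut uh uth : ℂ) : Prop :=
  (q ^ 2 - a ^ 2) * (u - uh) * (ut - uth) - (p ^ 2 - a ^ 2) * (u - ut) * (uh - uth)
      + (p ^ 2 - a ^ 2) * (q ^ 2 - a ^ 2) * (q ^ 2 - p ^ 2) * (u + ut + uh + uth)
    = (p ^ 2 - a ^ 2) * (q ^ 2 - a ^ 2) * (q ^ 2 - p ^ 2)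
      * ((p ^ 2 - a ^ 2) ^ 2 + (q ^ 2 - a ^ 2) ^ 2 - (p ^ 2 - a ^ 2) * (q ^ 2 - a ^ 2))

/-- Lower triangular Toeplitz matrices. -/
def IsLowerToeplitz {N : ℕ} (T : Matrix (Fin N) (Fin N) ℂ) : Prop :=
  ∃ t : ℕ → ℂ, ∀ i j : Fin N, T i j = if j ≤ i then t (i.val - j.val) else 0

/-- The branch of `k ↦ (c + k) ^ (l + 1/2)`, analytic near `k = 0` for every `c ≠ 0`, whose value
at `k = 0` is the principal value of `c ^ (l + 1/2)`. -/
def halfPow (c : ℂ) (l : ℕ) (k : ℂ) : ℂ :=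
  c ^ ((l : ℂ) + 1 / 2) * (1 + k / c) ^ ((l : ℂ) + 1 / 2)

/-- The function `φ⁺_s(α, β, l)` (for `σ = 1`) and `φ⁻_s(α, β, l)` (for `σ = -1`) at the lattice
point `(n, m)`:
`(1 / (2s)!) ∂_k^{2s} [(p+σk)^n (q+σk)^m (a+σk)^α (b+σk)^β (c+σk)^{l+1/2}]` at `k = 0`. -/
def nqcPhi (p q a b c σ : ℂ) (s : ℕ) (n m α β : ℤ) (l : ℕ) : ℂ :=
  iteratedDeriv (2 * s)
    (fun k : ℂ => (p + σ * k) ^ n * (q + σ * k) ^ m * (a + σ * k) ^ α * (b + σ * k) ^ β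
      * halfPow c l (σ * k)) 0 / ((2 * s).factorial : ℂ)

/-- The basic column vector `Φ(α, β, l) = 𝒜₊ Φ⁺(α, β, l) + 𝒜₋ Φ⁻(α, β, l)` of length `N`. -/
def nqcVec {N : ℕ} (p q c : ℂ) (Ap Am : Matrix (Fin N) (Fin N) ℂ) (a b : ℂ)
    (n m α β : ℤ) (l : ℕ) : Fin N → ℂ :=
  Ap.mulVec (fun s : Fin N => nqcPhi p q a b c 1 s n m α β l)
    + Am.mulVec (fun s : Fin N => nqcPhi p q a b c (-1) s n m α β l)

/-- The Casoratian `|Φ(α, β, 0), Φ(α, β, 1), …, Φ(α, β, N - 1)|`. -/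
def casoratian {N : ℕ} (p q c : ℂ) (Ap Am : Matrix (Fin N) (Fin N) ℂ) (a b : ℂ)
    (n m α β : ℤ) : ℂ :=
  Matrix.det (Matrix.of fun i l : Fin N => nqcVec p q c Ap Am a b n m α β l i)

/-- `f = |Φ(0, 0, 0), …, Φ(0, 0, N - 1)|`.  As `α = β = 0` here, the powers of `a ± k` and `b ± k`
are absent and we may take `a = b = 1`. -/
def nqcF {N : ℕ} (p q c : ℂ) (Ap Am : Matrix (Fin N) (Fin N) ℂ) (n m : ℤ) : ℂ :=
  casoratian p q c Ap Am 1 1 n m 0 0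

theorem casoratian_zero_zero {N : ℕ} (p q c : ℂ) (Ap Am : Matrix (Fin N) (Fin N) ℂ) (a b : ℂ)
    (n m : ℤ) : casoratian p q c Ap Am a b n m 0 0 = nqcF p q c Ap Am n m := by
  simp [nqcF, casoratian, nqcVec, nqcPhi]

/-- `θ = -((ab)^N |Φ(-1, -1, 0), …, Φ(-1, -1, N - 1)| - f) / (a + b)`, for `a + b ≠ 0`. -/
def nqcTheta {N : ℕ} (p q c : ℂ) (Ap Am : Matrix (Fin N) (Fin N) ℂ) (a b : ℂ) (n m : ℤ) : ℂ :=
  -(1 / (a + b)) * ((a * b) ^ N * casoratian p q c Ap Am a b n m (-1) (-1)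
    - nqcF p q c Ap Am n m)

open Classical in
/-- The rational solution `S(a, b) = θ / f` of the NQC equation.  Its singularity at `b = -a` is
removable, and `S(a, -a)` is the limit of `S(a, b)` as `b → -a`. -/
def nqcS {N : ℕ} (p q c : ℂ) (Ap Am : Matrix (Fin N) (Fin N) ℂ) (n m : ℤ) (a b : ℂ) : ℂ :=
  if a + b = 0 then
    limUnder (𝓝[≠] b) (fun b' : ℂ => nqcTheta p q c Ap Am a b' n m / nqcF p q c Ap Am n m)
  else nqcTheta p q c Ap Am a b n m / nqcF p q c Ap Am n m

/-- `U(a, -a) = -(1 / 2a) ∂_ε S(a, 2aε - a)` at `ε = 0`. -/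
def nqcUPlus {N : ℕ} (p q c : ℂ) (Ap Am : Matrix (Fin N) (Fin N) ℂ) (n m : ℤ) (a : ℂ) : ℂ :=
  -(1 / (2 * a)) * deriv (fun ε : ℂ => nqcS p q c Ap Am n m a (2 * a * ε - a)) 0

/-- `U(-a, a) = (1 / 2a) ∂_ε S(-a, a - 2aε)` at `ε = 0`. -/
def nqcUMinus {N : ℕ} (p q c : ℂ) (Ap Am : Matrix (Fin N) (Fin N) ℂ) (n m : ℤ) (a : ℂ) : ℂ :=
  1 / (2 * a) * deriv (fun ε : ℂ => nqcS p q c Ap Am n m (-a) (a - 2 * a * ε)) 0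

/-- `ξ = 2a (p n / (a² - p²) + q m / (a² - q²))`. -/
def latticeXi (p q a : ℂ) (n m : ℤ) : ℂ :=
  2 * a * (p / (a ^ 2 - p ^ 2) * n + q / (a ^ 2 - q ^ 2) * m)

/-- `ρ(a) = ((p + a) / (p - a))^n ((q + a) / (q - a))^m`. -/
def latticeRho (p q a : ℂ) (n m : ℤ) : ℂ :=
  ((p + a) / (p - a)) ^ n * ((q + a) / (q - a)) ^ m

/-- The function `u` solving Q2, with constants `ξ₀`, `A`, `D`. -/
def q2Sol {N : ℕ} (p q c : ℂ) (Ap Am : Matrix (Fin N) (Fin N) ℂ) (a ξ₀ A D : ℂ)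
    (n m : ℤ) : ℂ :=
  1 / 4 * ((latticeXi p q a n m + ξ₀) ^ 2 + 1)
    + a * (latticeXi p q a n m + ξ₀) * nqcS p q c Ap Am n m (-a) a
    + a ^ 2 * (nqcUPlus p q c Ap Am n m a + nqcUMinus p q c Ap Am n m a)
    + A * D
    + 1 / 2 * A * latticeRho p q a n m * (1 - 2 * a * nqcS p q c Ap Am n m a a)
    + 1 / 2 * D * latticeRho p q (-a) n m * (1 + 2 * a * nqcS p q c Ap Am n m (-a) (-a))

/-- The plane wave factor `Ϝ(a, b) = (P / ((p-a)(p-b)))^n (Q / ((q-a)(q-b)))^m` of the solution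
of Q3. -/
def q3Factor (p q P Q a b : ℂ) (n m : ℤ) : ℂ :=
  (P / ((p - a) * (p - b))) ^ n * (Q / ((q - a) * (q - b))) ^ m

/-- The rational expression solving Q3, built from `S(±a, ±b)`, with constants `A`, `B`, `C`,
`D`. -/
def q3Sol {N : ℕ} (p q c : ℂ) (Ap Am : Matrix (Fin N) (Fin N) ℂ) (P Q a b A B C D : ℂ)
    (n m : ℤ) : ℂ :=
  A * q3Factor p q P Q a b n m * (1 - (a + b) * nqcS p q c Ap Am n m a b)
    + B * q3Factor p q P Q a (-b) n m * (1 - (a - b) * nqcS p q c Ap Am n m a (-b))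
    + C * q3Factor p q P Q (-a) b n m * (1 + (a - b) * nqcS p q c Ap Am n m (-a) b)
    + D * q3Factor p q P Q (-a) (-b) n m * (1 + (a + b) * nqcS p q c Ap Am n m (-a) (-b))

/-- The Q3 solution after the substitution `b = a(1 - 2ε)` and the replacement of its constants
by the `ε`-dependent ones, with `P`, `Q` the values of the curve coordinates for this `b`. -/
def q3SolDegen {N : ℕ} (p q c : ℂ) (Ap Am : Matrix (Fin N) (Fin N) ℂ) (P Q a ξ₀ A D δ ε : ℂ)
    (n m : ℤ) : ℂ :=
  q3Sol p q c Ap Am P Q a (a * (1 - 2 * ε))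
    (δ / (4 * a ^ 2) * A * ε)
    (δ / (8 * a ^ 2) * (1 / ε + 1 - ξ₀ + ((3 + ξ₀ ^ 2) / 2 + 2 * A * D) * ε))
    (δ / (8 * a ^ 2) * (1 / ε + 1 + ξ₀ + ((3 + ξ₀ ^ 2) / 2 + 2 * A * D) * ε))
    (δ / (4 * a ^ 2) * D * ε) n m

end

/-! Everything is a Miwa shift of one determinant. Even derivatives at 0 do not see `k ↦ -k`, so φ⁻
= φ⁺, and each Casoratian is `(Ap + Am).det` times `tau N` of the Taylor series `g` of (p+k)^n
(q+k)^m (c+k)^(1/2), multiplied by the series of (a+k)^α (b+k)^β. As `tau` reads only even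
coefficients in its first column and the columns are successive shifts, a factor d + e X²
contributes just d^N. Hence n → n+1 is, up to a constant, `g ↦ g * miwa (-1 / p)`, and 1/(a+k) =
(a-k)/(a²-k²) may be replaced by `miwa (1 / a)` after rescaling. Thus 1 - (a+b) S(a,b) = τ(g ·
miwa(1/a) · miwa(1/b)) / τ(g), and all relations needed come from the Plücker identity
`tau_bilinear` and the reduction `tau_miwa_neg`.

For Q2, `miwaQuot_derivative` removes the U-terms and `q2Sol_eq` gives 4u = R² + XY with X = ρV +
2D, Y = W/ρ + 2A, where V, W are the values of `tauRatioSq` at ±1/a and R is ξ + ξ₀ corrected by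
`quotRatio`. So -4u is the determinant of the quadratic form Q(v,w) = Y v² - 2R v w - X w². By
`edge_shift` a lattice step changes R, X, Y by products of values of `tauRatio`; the increments of u
over the square are then affine in Q(α), Q(β) and the polarization Q(α,β) for two vectors α, β read
off at the shifted points. Q2 amounts to the Gram identity Q(α)Q(β) - Q(α,β)² = -4u (α∧β)², with α∧β
known from the bilinear relations (`quad_of_increments`, `solForm_quad`).

For the degeneration, the factors multiplying B' and C' are inverse to each other and the square of
one is an explicit differentiable function of ε. The 1/ε poles therefore require only first
derivatives (`tendsto_degeneration`).

For rationality, (1+k/p)^n has Taylor coefficients polynomial in n, and `tau` and `miwaQuot` commute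
with ring homomorphisms, so both can be formed over the polynomial ring in n, m and then
specialized. -/

noncomputable section

/-! ### The tau function and its invariance under even factors -/

section TauFunction

open Matrix PowerSeries

variable {R : Type*} [CommRing R]

/-- The determinant `|coeff (2 i) (g * X ^ j)|` of size `N`. -/
def tau (N : ℕ) (g : R⟦X⟧) : R :=
  Matrix.det (Matrix.of fun i j : Fin N => coeff (2 * (i : ℕ)) (g * X ^ (j : ℕ)))

/-- The factor `1 - x X` implementing a Miwa shift. -/
def miwa (x : R) : R⟦X⟧ := 1 - C x * X

theorem miwa_zero : miwa (0 : R) = 1 := by simp [miwa]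

theorem tau_map {S : Type*} [CommRing S] (φ : R →+* S) (N : ℕ) (g : R⟦X⟧) :
    φ (tau N g) = tau N (PowerSeries.map φ g) := by
  unfold tau
  rw [RingHom.map_det]
  congr 1
  ext i j
  simp only [RingHom.mapMatrix_apply, Matrix.map_apply, Matrix.of_apply]
  rw [← PowerSeries.coeff_map]
  simp

theorem map_miwa {S : Type*} [CommRing S] (φ : R →+* S) (x : R) :
    PowerSeries.map φ (miwa x) = miwa (φ x) := by
  simp [miwa]

theorem tau_C_mul (N : ℕ) (d : R) (g : R⟦X⟧) : tau N (C d * g) = d ^ N * tau N g := by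
  unfold tau
  have := Matrix.det_smul (Matrix.of fun i j : Fin N => coeff (2 * (i : ℕ)) (g * X ^ (j : ℕ))) d
  rw [Fintype.card_fin] at this
  rw [← this]
  congr 1
  ext i j
  simp [mul_assoc]

/-- Multiplication by an even series of the form `d + e X ^ 2`. -/
theorem tau_even_mul (N : ℕ) (d e : R) (g : R⟦X⟧) :
    tau N ((C d + C e * X ^ 2) * g) = d ^ N * tau N g := by
  unfold tau
  -- Row `i` reads the coefficient of index 2i, so multiplication by X² lowers the row index by one:
  -- the even factor acts on the left as a bidiagonal matrix.
  have hT : (Matrix.of fun i j : Fin N => if i = j then d else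
      if (i : ℕ) = j + 1 then e else 0).det = d ^ N := by
    rw [Matrix.det_of_isLowerTriangular]
    · simp
    · intro i j hij
      have : (i : ℕ) < j := hij
      simp only [Matrix.of_apply]
      rw [if_neg (by rintro rfl; omega), if_neg (by omega)]
  rw [← hT, ← Matrix.det_mul]
  congr 1
  ext i j
  simp only [Matrix.of_apply, Matrix.mul_apply]
  have h1 : (C d + C e * X ^ 2) * g * X ^ (j : ℕ)
      = C d * (g * X ^ (j : ℕ)) + C e * ((g * X ^ (j : ℕ)) * X ^ 2) := by ring
  rw [h1, map_add, coeff_C_mul, coeff_C_mul, coeff_mul_X_pow' (g * X ^ (j : ℕ)) 2]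
  have h2 : ∀ k : Fin N, (if i = k then d else if (i : ℕ) = k + 1 then e else 0)
      = (if i = k then d else 0) + (if (i : ℕ) = k + 1 then e else 0) := by
    intro k
    by_cases h : i = k
    · subst h; simp
    · simp [h]
  simp only [h2, add_mul, Finset.sum_add_distrib, ite_mul, zero_mul, Finset.sum_ite_eq,
    Finset.mem_univ, if_true]
  refine congrArg₂ _ rfl ?_
  obtain ⟨i, hi⟩ := i
  rcases i with _ | i
  · simp
  · have h3 : 2 * (i + 1) - 2 = 2 * i := by omega
    rw [if_pos (by simp only; omega), Finset.sum_eq_single (⟨i, by omega⟩ : Fin N)]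
    · simp [h3]
    · intro k _ hk
      rw [if_neg]
      intro h
      apply hk
      ext
      simp only at h ⊢
      omega
    · simp

/-- The product is 1 - x² X², an even factor with constant term 1. This reduction (of KdV type)
makes the singularity of S(a,b) at b = -a removable. -/
theorem tau_miwa_neg (N : ℕ) (x : R) (g : R⟦X⟧) : tau N (g * (miwa x * miwa (-x))) = tau N g := by
  have := tau_even_mul N 1 (-x ^ 2) g
  rw [one_pow, one_mul] at this
  rw [← this]
  congr 1
  simp only [miwa, map_neg, map_pow, map_one]
  ring

/-! ### Plücker relation and the bilinear identity -/

section Pluecker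

variable {N : ℕ}

/-- The bordered matrix with two additional rows `r`, `s`. -/
def bordered (N : ℕ) (g : R⟦X⟧) (r : Fin 2 → Fin (N + 2) → R) :
    Matrix (Fin N ⊕ Fin 2) (Fin (N + 2)) R :=
  Matrix.of (Sum.elim (fun i j => coeff (2 * (i : ℕ)) (g * X ^ (j : ℕ))) r)

/-- The determinant of the bordered matrix. -/
def bracket (g : R⟦X⟧) (r : Fin 2 → Fin (N + 2) → R) : R :=
  ((bordered N g r).submatrix id finSumFinEquiv).det

theorem bracket_updateRow_zero (g : R⟦X⟧) (r s t : Fin (N + 2) → R) :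
    (((bordered N g ![r, s]).submatrix id finSumFinEquiv).updateRow (Sum.inr 0)
      (t ∘ finSumFinEquiv)).det = bracket g ![t, s] := by
  unfold bracket
  congr 1
  ext i j
  rcases i with i | i
  · simp [bordered, Matrix.updateRow_apply]
  · fin_cases i <;> simp [bordered, Matrix.updateRow_apply]

theorem bracket_updateRow_one (g : R⟦X⟧) (r s t : Fin (N + 2) → R) :
    (((bordered N g ![r, s]).submatrix id finSumFinEquiv).updateRow (Sum.inr 1)
      (t ∘ finSumFinEquiv)).det = bracket g ![r, t] := by
  unfold bracket
  congr 1
  ext i j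
  rcases i with i | i
  · simp [bordered, Matrix.updateRow_apply]
  · fin_cases i <;> simp [bordered, Matrix.updateRow_apply]

theorem bracket_swap (g : R⟦X⟧) (r s : Fin (N + 2) → R) :
    bracket g ![r, s] = - bracket g ![s, r] := by
  unfold bracket
  have := Matrix.det_permute (Equiv.swap (Sum.inr 0 : Fin N ⊕ Fin 2) (Sum.inr 1))
    ((bordered N g ![s, r]).submatrix id finSumFinEquiv)
  rw [Equiv.Perm.sign_swap (by simp)] at this
  simp only [Units.val_neg, Units.val_one, Int.cast_neg, Int.cast_one, neg_mul, one_mul] at this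
  rw [← this]
  congr 1
  ext i j
  rcases i with i | i
  · simp [bordered, Equiv.swap_apply_def]
  · fin_cases i <;> simp [bordered]

/-- Three-term Plücker relation. -/
theorem bracket_pluecker (g : R⟦X⟧) (r₁ r₂ r₃ r₄ : Fin (N + 2) → R) :
    bracket g ![r₁, r₂] * bracket g ![r₃, r₄] - bracket g ![r₁, r₃] * bracket g ![r₂, r₄]
      + bracket g ![r₁, r₄] * bracket g ![r₂, r₃] = 0 := by
  set A := (bordered N g ![r₁, r₂]).submatrix id finSumFinEquiv with hA
  set B := (bordered N g ![r₃, r₄]).submatrix id finSumFinEquiv with hB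
  set b := r₃ ∘ (finSumFinEquiv : Fin N ⊕ Fin 2 ≃ Fin (N + 2)) with hb
  -- Cramer's rule expands det A · r₃ in the rows of A; putting each side into the first border row
  -- of B, a linear operation, gives the relation.
  have h1 := Matrix.mulVec_cramer Aᵀ b
  have h2 := congrArg (fun t => Bᵀ.cramer t (Sum.inr 0)) h1
  have h3 : Aᵀ *ᵥ Aᵀ.cramer b = ∑ i, Aᵀ.cramer b i • A i := by
    ext j
    simp [Matrix.mulVec, dotProduct, mul_comm]
  simp only [h3, map_sum, map_smul, Finset.sum_apply, Pi.smul_apply, smul_eq_mul] at h2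
  -- Rows of A other than r₁, r₂ already occur in B, so their terms have a repeated row.
  have h4 : ∀ i : Fin N, (B.updateRow (Sum.inr 0) (A (Sum.inl i))).det = 0 := by
    intro i
    refine Matrix.det_zero_of_row_eq (i := Sum.inl i) (j := Sum.inr 0) (by simp) ?_
    ext j
    simp [Matrix.updateRow_apply, hA, hB, bordered]
  have h5 : A (Sum.inr 0) = r₁ ∘ finSumFinEquiv := by
    ext j
    simp [hA, bordered]
  have h6 : A (Sum.inr 1) = r₂ ∘ finSumFinEquiv := by
    ext j
    simp [hA, bordered]
  simp only [Matrix.cramer_transpose_apply, Fintype.sum_sum_type, Fin.sum_univ_two, h4, mul_zero,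
    Finset.sum_const_zero, zero_add, Matrix.det_transpose, h5, h6] at h2
  simp only [hA, hB, hb, bracket_updateRow_zero, bracket_updateRow_one] at h2
  change _ = bracket g ![r₁, r₂] * _ at h2
  rw [← h2, bracket_swap g r₃ r₂]
  ring

/-- Replacing column l < N by (column l) - (x+y)(column l+1) + xy(column l+2) annihilates both
geometric border rows and multiplies g by (1-xX)(1-yX). The last two columns contribute the 2×2
determinant x - y. -/
theorem bracket_eq_tau (g : R⟦X⟧) (x y : R) :
    bracket (N := N) g ![fun j => x ^ (N + 1 - (j : ℕ)), fun j => y ^ (N + 1 - (j : ℕ))]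
      = (x - y) * tau N (g * (miwa x * miwa y)) := by
  -- The unipotent matrix of these column operations; the last two columns stay unchanged.
  set c : Matrix (Fin (N + 2)) (Fin (N + 2)) R := Matrix.of fun k l =>
    if k = l then 1 else if (l : ℕ) < N then
      (if (k : ℕ) = l + 1 then -(x + y) else if (k : ℕ) = l + 2 then x * y else 0) else 0 with hc
  have hdet : c.det = 1 := by
    rw [Matrix.det_of_isLowerTriangular]
    · simp [hc]
    · intro i j hij
      have : (i : ℕ) < j := hij
      simp only [hc, Matrix.of_apply]
      rw [if_neg (by rintro rfl; omega)]
      split_ifs <;> first | rfl | omega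
  have hdet' : (c.submatrix finSumFinEquiv finSumFinEquiv).det = 1 := by
    rw [Matrix.det_submatrix_equiv_self, hdet]
  have hsum : ∀ (F : Fin (N + 2) → R) (l : Fin N),
      ∑ k, F k * c k (finSumFinEquiv (Sum.inl l)) = F ⟨l, by omega⟩ - (x + y) * F ⟨l + 1, by omega⟩
        + x * y * F ⟨l + 2, by omega⟩ := by
    intro F l
    have hl := l.isLt
    have h : ∀ k : Fin (N + 2), F k * c k (finSumFinEquiv (Sum.inl l))
        = (if k = ⟨l, by omega⟩ then F k else 0)
          + (if k = ⟨l + 1, by omega⟩ then -(x + y) * F k else 0)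
          + (if k = ⟨l + 2, by omega⟩ then x * y * F k else 0) := by
      intro k
      simp only [hc, Matrix.of_apply, Fin.ext_iff, finSumFinEquiv_apply_left, Fin.val_castAdd, hl,
        if_true]
      split_ifs <;> first | omega | ring
    simp only [h, Finset.sum_add_distrib, Finset.sum_ite_eq', Finset.mem_univ, if_true]
    ring
  have hsum2 : ∀ (F : Fin (N + 2) → R) (l : Fin 2),
      ∑ k, F k * c k (finSumFinEquiv (Sum.inr l)) = F ⟨N + l, by omega⟩ := by
    intro F l
    rw [Finset.sum_eq_single ⟨N + l, by omega⟩]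
    · simp [hc, Fin.ext_iff]
    · intro k _ hk
      have : ¬ (k : ℕ) = N + l := fun h => hk (Fin.ext h)
      simp [hc, Fin.ext_iff, this]
    · simp
  unfold bracket
  rw [← mul_one (Matrix.det _), ← hdet', ← Matrix.det_mul, Matrix.submatrix_mul_equiv]
  have hblock : (bordered N g ![fun j => x ^ (N + 1 - (j : ℕ)), fun j => y ^ (N + 1 - (j : ℕ))]
      * c).submatrix id finSumFinEquiv = Matrix.fromBlocks
        (Matrix.of fun i j : Fin N =>
          coeff (2 * (i : ℕ)) (g * (miwa x * miwa y) * X ^ (j : ℕ)))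
        (Matrix.of fun (i : Fin N) (j : Fin 2) => coeff (2 * (i : ℕ)) (g * X ^ (N + (j : ℕ))))
        0 !![x, 1; y, 1] := by
    ext i j
    rcases i with i | i <;> rcases j with j | j
    · simp only [Matrix.submatrix_apply, Matrix.mul_apply, hsum, id_eq]
      simp only [bordered, Matrix.of_apply, Sum.elim_inl, Matrix.fromBlocks_apply₁₁]
      have : g * (miwa x * miwa y) * X ^ (j : ℕ) = g * X ^ (j : ℕ)
          - C (x + y) * (g * X ^ ((j : ℕ) + 1)) + C (x * y) * (g * X ^ ((j : ℕ) + 2)) := by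
        simp only [miwa, map_add, map_mul]
        ring
      rw [this, map_add, map_sub, coeff_C_mul, coeff_C_mul]
    · simp only [Matrix.submatrix_apply, Matrix.mul_apply, hsum2, id_eq]
      simp [bordered]
    · simp only [Matrix.submatrix_apply, Matrix.mul_apply, hsum, id_eq]
      have hj := j.isLt
      -- Since j < N, all three exponents are genuine, without truncated subtraction, and x^(k+2) -
      -- (x+y) x^(k+1) + xy x^k = 0.
      obtain ⟨k, hk⟩ : ∃ k, N + 1 - (j : ℕ) = k + 2 := ⟨N - 1 - j, by omega⟩
      have hk1 : N + 1 - ((j : ℕ) + 1) = k + 1 := by omega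
      have hk2 : N + 1 - ((j : ℕ) + 2) = k := by omega
      fin_cases i <;> simp [bordered, hk, hk1, hk2] <;> ring
    · simp only [Matrix.submatrix_apply, Matrix.mul_apply, hsum2, id_eq]
      fin_cases i <;> fin_cases j <;> simp [bordered]
  rw [hblock, Matrix.det_fromBlocks_zero₂₁, Matrix.det_fin_two_of]
  unfold tau
  ring

/-- The four-point bilinear identity of the KP hierarchy for `tau`. -/
theorem tau_bilinear (N : ℕ) (g : R⟦X⟧) (x y z w : R) :
    (x - y) * (z - w) * tau N (g * (miwa x * miwa y)) * tau N (g * (miwa z * miwa w))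
      - (x - z) * (y - w) * tau N (g * (miwa x * miwa z)) * tau N (g * (miwa y * miwa w))
      + (x - w) * (y - z) * tau N (g * (miwa x * miwa w)) * tau N (g * (miwa y * miwa z)) = 0 := by
  have := bracket_pluecker (N := N) g (fun j => x ^ (N + 1 - (j : ℕ)))
    (fun j => y ^ (N + 1 - (j : ℕ))) (fun j => z ^ (N + 1 - (j : ℕ)))
    (fun j => w ^ (N + 1 - (j : ℕ)))
  simp only [bracket_eq_tau] at this
  linear_combination this

end Pluecker

end TauFunction

/-! ### Algebra of Q2 on a single square -/

section QuadEquation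

/-- Change of `u = (R ^ 2 + X * Y) / 4` along an edge of the lattice. -/
theorem edge_increment {a p q R X Y v v' w' v'' w'' H : ℂ} (ha : a ≠ 0)
    (h1 : p - a ≠ 0) (h2 : p + a ≠ 0) (hH : H ≠ 0)
    (hW : (p - a) * (q + a) * w' * v'' - (p + a) * (q - a) * v' * w'' = 2 * a * H) {w : ℂ}
    (hv : v = ((p + a) * v' - (q + a) * v'') / H) (hw : w = ((p - a) * w' - (q - a) * w'') / H) :
    (R - a * (v' * w / (p - a) + w' * v / (p + a))) ^ 2
      + (X + 2 * a * v' * v / (p - a)) * (Y - 2 * a * w' * w / (p + a))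
    = R ^ 2 + X * Y + 4 * (a ^ 2 / (p ^ 2 - a ^ 2)) ^ 2
      + 2 * a / H * (-2 * R * v' * w' + Y * ((p + a) / (p - a)) * v' ^ 2
        - X * ((p - a) / (p + a)) * w' ^ 2
        - (-R * ((q - a) * (p + a) * v' * w'' + (q + a) * (p - a) * w' * v'')
          + Y * (q + a) * (p + a) * v' * v'' - X * (q - a) * (p - a) * w' * w'')
          / (p ^ 2 - a ^ 2)) := by
  have hH' : H = ((p - a) * (q + a) * w' * v'' - (p + a) * (q - a) * v' * w'') / (2 * a) := by
    field_simp
    linear_combination -hW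
  have h3 : p ^ 2 - a ^ 2 = (p - a) * (p + a) := by ring
  rw [h3]
  subst hv hw
  field_simp
  rw [hH']
  field_simp
  ring

/-- After eliminating v, w, v₂, w₂, the total changes of R, X, Y across the diagonal share the
factor 1/(q²-a²) - 1/(p²-a²). Their linear contribution is the polarized form; their quadratic one
is a multiple of the squared wedge product, hence a constant. -/
theorem face_increment {a p q R X Y v v' w' v'' w'' H : ℂ} (ha : a ≠ 0)
    (h1 : p - a ≠ 0) (h2 : p + a ≠ 0) (h3 : q - a ≠ 0) (h4 : q + a ≠ 0) (hH : H ≠ 0)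
    (hW : (p - a) * (q + a) * w' * v'' - (p + a) * (q - a) * v' * w'' = 2 * a * H) {w v₂ w₂ : ℂ}
    (hv : v = ((p + a) * v' - (q + a) * v'') / H) (hw : w = ((p - a) * w' - (q - a) * w'') / H)
    (hv₂ : v₂ = ((p - a) * v'' - (q - a) * v') / H)
    (hw₂ : w₂ = ((p + a) * w'' - (q + a) * w') / H) :
    (R - a * (v' * w / (p - a) + w' * v / (p + a)) - a * (v₂ * w' / (q - a) + w₂ * v' / (q + a))) ^ 2
      + (X + 2 * a * v' * v / (p - a) + 2 * a * ((p + a) / (p - a)) * v₂ * v' / (q - a))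
        * (Y - 2 * a * w' * w / (p + a) - 2 * a * ((p - a) / (p + a)) * w₂ * w' / (q + a))
    = R ^ 2 + X * Y + 4 * (a ^ 2 / (p ^ 2 - a ^ 2) - a ^ 2 / (q ^ 2 - a ^ 2)) ^ 2
      + 2 * a / H * (-R * ((q - a) * (p + a) * v' * w'' + (q + a) * (p - a) * w' * v'')
          + Y * (q + a) * (p + a) * v' * v'' - X * (q - a) * (p - a) * w' * w'')
          * (1 / (q ^ 2 - a ^ 2) - 1 / (p ^ 2 - a ^ 2)) := by
  have hH' : H = ((p - a) * (q + a) * w' * v'' - (p + a) * (q - a) * v' * w'') / (2 * a) := by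
    field_simp
    linear_combination -hW
  have h5 : p ^ 2 - a ^ 2 = (p - a) * (p + a) := by ring
  have h6 : q ^ 2 - a ^ 2 = (q - a) * (q + a) := by ring
  rw [h5, h6]
  have e1 : a * (v' * w / (p - a) + w' * v / (p + a)) + a * (v₂ * w' / (q - a) + w₂ * v' / (q + a))
      = a / H * ((q + a) * (p - a) * w' * v'' + (q - a) * (p + a) * v' * w'')
        * (1 / ((q - a) * (q + a)) - 1 / ((p - a) * (p + a))) := by
    subst hv hw hv₂ hw₂
    field_simp
    ring
  have e2 : 2 * a * v' * v / (p - a) + 2 * a * ((p + a) / (p - a)) * v₂ * v' / (q - a)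
      = 2 * a / H * (q + a) * (p + a) * v' * v''
        * (1 / ((q - a) * (q + a)) - 1 / ((p - a) * (p + a))) := by
    subst hv hw hv₂ hw₂
    field_simp
    ring
  have e3 : 2 * a * w' * w / (p + a) + 2 * a * ((p - a) / (p + a)) * w₂ * w' / (q + a)
      = 2 * a / H * (q - a) * (p - a) * w' * w''
        * (1 / ((q - a) * (q + a)) - 1 / ((p - a) * (p + a))) := by
    subst hv hw hv₂ hw₂
    field_simp
    ring
  rw [sub_sub, add_assoc X, sub_sub Y, e1, e2, e3]
  -- The quadratic terms combine as (x+y)² - 4xy = (x-y)², which `hW` evaluates.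
  have e4 : ((p - a) * (q + a) * w' * v'' - (p + a) * (q - a) * v' * w'') ^ 2 * (a / H) ^ 2
      = 4 * a ^ 4 := by
    rw [hW]
    field_simp
    ring
  have e5 : a ^ 2 / ((p - a) * (p + a)) - a ^ 2 / ((q - a) * (q + a))
    = -a ^ 2 * (1 / ((q - a) * (q + a)) - 1 / ((p - a) * (p + a))) := by ring
  rw [e5]
  generalize 1 / ((q - a) * (q + a)) - 1 / ((p - a) * (p + a)) = k
  have e6 : 2 * a / H = 2 * (a / H) := by ring
  rw [e6]
  linear_combination k ^ 2 * e4

/-- Here A, G, B are, up to normalization, Q(α), Q(β) and Q(α,β); `h4` is the Gram determinant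
identity. Substituting the increments into Q2 leaves exactly a multiple of it. -/
theorem quad_of_increments {u ut uh uth A B G k s t : ℂ}
    (h1 : 4 * (ut - u) = 4 * s ^ 2 + k * (A - B * s))
    (h2 : 4 * (uh - u) = 4 * t ^ 2 + k * (B * t - G))
    (h3 : 4 * (uth - u) = 4 * (s - t) ^ 2 + k * B * (t - s))
    (h4 : k ^ 2 * (A * G - B ^ 2 * s * t) = -64 * s * t * u) : Q2Eq s t u ut uh uth := by
  have e1 : ut = u + (4 * s ^ 2 + k * (A - B * s)) / 4 := by linear_combination h1 / 4
  have e2 : uh = u + (4 * t ^ 2 + k * (B * t - G)) / 4 := by linear_combination h2 / 4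
  have e3 : uth = u + (4 * (s - t) ^ 2 + k * B * (t - s)) / 4 := by linear_combination h3 / 4
  rw [Q2Eq, e1, e2, e3]
  linear_combination (s - t) / 16 * h4

theorem q2Param_of_q2 {p q a : ℂ} (ha : a ≠ 0) (hp : p ^ 2 - a ^ 2 ≠ 0) (hq : q ^ 2 - a ^ 2 ≠ 0)
    {u ut uh uth : ℂ}
    (h : Q2Eq (a ^ 2 / (p ^ 2 - a ^ 2)) (a ^ 2 / (q ^ 2 - a ^ 2)) u ut uh uth) :
    Q2ParamEq p q a ((p ^ 2 - a ^ 2) ^ 2 * (q ^ 2 - a ^ 2) ^ 2 / a ^ 4 * u)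
      ((p ^ 2 - a ^ 2) ^ 2 * (q ^ 2 - a ^ 2) ^ 2 / a ^ 4 * ut)
      ((p ^ 2 - a ^ 2) ^ 2 * (q ^ 2 - a ^ 2) ^ 2 / a ^ 4 * uh)
      ((p ^ 2 - a ^ 2) ^ 2 * (q ^ 2 - a ^ 2) ^ 2 / a ^ 4 * uth) := by
  unfold Q2Eq at h
  unfold Q2ParamEq
  have h5 : q ^ 2 - p ^ 2 = (q ^ 2 - a ^ 2) - (p ^ 2 - a ^ 2) := by ring
  rw [h5]
  generalize p ^ 2 - a ^ 2 = s at *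
  generalize q ^ 2 - a ^ 2 = t at *
  field_simp at h ⊢
  linear_combination h

end QuadEquation

/-! ### Removing the singularity at y = -x; three-point relations -/

section MiwaQuotient

open PowerSeries

variable {R : Type*} [CommRing R]

/-- The polynomial `y ↦ tau N (g * (miwa x * miwa y))`. -/
def miwaPoly (N : ℕ) (g : R⟦X⟧) (x : R) : Polynomial R :=
  tau N (PowerSeries.map Polynomial.C g * (miwa (Polynomial.C x) * miwa Polynomial.X))

theorem eval_miwaPoly (N : ℕ) (g : R⟦X⟧) (x y : R) :
    (miwaPoly N g x).eval y = tau N (g * (miwa x * miwa y)) := by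
  have h : (PowerSeries.map (Polynomial.evalRingHom y)) (PowerSeries.map Polynomial.C g) = g := by
    ext n
    simp
  rw [miwaPoly, ← Polynomial.coe_evalRingHom, tau_map, map_mul, map_mul, map_miwa, map_miwa, h]
  simp

theorem map_miwaPoly {S : Type*} [CommRing S] (φ : R →+* S) (N : ℕ) (g : R⟦X⟧) (x : R) :
    (miwaPoly N g x).map φ = miwaPoly N (PowerSeries.map φ g) (φ x) := by
  have h : (PowerSeries.map (Polynomial.mapRingHom φ)) (PowerSeries.map Polynomial.C g)
      = PowerSeries.map Polynomial.C (PowerSeries.map φ g) := by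
    ext n
    simp
  rw [miwaPoly, ← Polynomial.coe_mapRingHom, tau_map, map_mul, map_mul, map_miwa, map_miwa, h]
  simp [miwaPoly]

/-- The polynomial quotient `(tau N g - tau N (g * (miwa x * miwa y))) / (x + y)` in `y`. -/
def miwaQuot (N : ℕ) (g : R⟦X⟧) (x : R) : Polynomial R :=
  (Polynomial.C (tau N g) - miwaPoly N g x) /ₘ (Polynomial.X - Polynomial.C (-x))

/-- By `tau_miwa_neg` the difference vanishes at y = -x, so the division by the monic X + x is exact
over any commutative ring. -/
theorem tau_mul_miwa (N : ℕ) (g : R⟦X⟧) (x y : R) :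
    tau N (g * (miwa x * miwa y)) = tau N g - (x + y) * (miwaQuot N g x).eval y := by
  have h : (Polynomial.C (tau N g) - miwaPoly N g x).IsRoot (-x) := by
    rw [Polynomial.IsRoot, Polynomial.eval_sub, Polynomial.eval_C, eval_miwaPoly, tau_miwa_neg,
      sub_self]
  have h2 := congrArg (Polynomial.eval y) (Polynomial.mul_divByMonic_eq_iff_isRoot.2 h)
  rw [Polynomial.eval_mul, Polynomial.eval_sub, Polynomial.eval_sub, eval_miwaPoly] at h2
  simp only [Polynomial.eval_X, Polynomial.eval_C] at h2
  rw [miwaQuot]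
  linear_combination h2

theorem map_miwaQuot {S : Type*} [CommRing S] (φ : R →+* S) (N : ℕ) (g : R⟦X⟧) (x : R) :
    (miwaQuot N g x).map φ = miwaQuot N (PowerSeries.map φ g) (φ x) := by
  rw [miwaQuot, Polynomial.map_divByMonic _ (Polynomial.monic_X_sub_C _), Polynomial.map_sub,
    map_miwaPoly, Polynomial.map_C, tau_map]
  simp [miwaQuot]

/-- The bilinear identity for g · miwa x at the points y, P, -x, 0, where -x cancels the extra
shift. It governs a lattice step: y = x yields `tauRatioSq`, while division by x + y followed by y =
-x yields `quotRatio`. -/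
theorem tau_shift (N : ℕ) (g : R⟦X⟧) (x y P : R) :
    y * (P + x) * tau N (g * (miwa x * miwa y)) * tau N (g * miwa P)
      - x * (y - P) * tau N (g * miwa P * (miwa x * miwa y)) * tau N g
      = P * (x + y) * tau N (g * miwa y) * tau N (g * miwa P * miwa x) := by
  have h := tau_bilinear N (g * miwa x) y P (-x) 0
  rw [miwa_zero] at h
  simp only [mul_one] at h
  have e1 : g * miwa x * (miwa y * miwa P) = g * miwa P * (miwa x * miwa y) := by ring
  have e2 : tau N (g * miwa x * miwa (-x)) = tau N g := by rw [mul_assoc, tau_miwa_neg]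
  have e3 : tau N (g * miwa x * (miwa y * miwa (-x))) = tau N (g * miwa y) := by
    rw [← tau_miwa_neg N x (g * miwa y)]
    congr 1
    ring
  have e4 : tau N (g * miwa x * (miwa P * miwa (-x))) = tau N (g * miwa P) := by
    rw [← tau_miwa_neg N x (g * miwa P)]
    congr 1
    ring
  have e5 : g * miwa x * miwa P = g * miwa P * miwa x := by ring
  have e6 : g * miwa x * miwa y = g * (miwa x * miwa y) := by ring
  rw [e1, e2, e3, e4, e5, e6] at h
  linear_combination h

theorem tau_cross (N : ℕ) (g : R⟦X⟧) (x P Q : R) :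
    (P - Q) * x * tau N (g * miwa P * miwa Q) * tau N (g * miwa x)
      = (P - x) * Q * tau N (g * miwa P * miwa x) * tau N (g * miwa Q)
        - (Q - x) * P * tau N (g * miwa Q * miwa x) * tau N (g * miwa P) := by
  have h := tau_bilinear N g P Q x 0
  rw [miwa_zero] at h
  simp only [mul_one, ← mul_assoc] at h
  linear_combination h

/-- The counterpart of `tau_cross` seen from the opposite corner: from g · miwa P · miwa Q the
points -P, -Q undo the shifts. -/
theorem tau_cross' (N : ℕ) (g : R⟦X⟧) (x P Q : R) :
    (P - Q) * x * tau N g * tau N (g * miwa P * miwa Q * miwa x)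
      = (Q + x) * P * tau N (g * miwa P * miwa x) * tau N (g * miwa Q)
        - (P + x) * Q * tau N (g * miwa Q * miwa x) * tau N (g * miwa P) := by
  have h := tau_bilinear N (g * miwa P * miwa Q) (-P) (-Q) x 0
  rw [miwa_zero] at h
  simp only [mul_one] at h
  have e1 : tau N (g * miwa P * miwa Q * (miwa (-P) * miwa (-Q))) = tau N g := by
    rw [← tau_miwa_neg N P g, ← tau_miwa_neg N Q (g * _)]
    congr 1
    ring
  have e2 : tau N (g * miwa P * miwa Q * (miwa (-P) * miwa x)) = tau N (g * miwa Q * miwa x) := by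
    rw [← tau_miwa_neg N P (g * miwa Q * miwa x)]
    congr 1
    ring
  have e3 : tau N (g * miwa P * miwa Q * (miwa (-Q) * miwa x)) = tau N (g * miwa P * miwa x) := by
    rw [← tau_miwa_neg N Q (g * miwa P * miwa x)]
    congr 1
    ring
  have e4 : tau N (g * miwa P * miwa Q * miwa (-P)) = tau N (g * miwa Q) := by
    rw [← tau_miwa_neg N P (g * miwa Q)]
    congr 1
    ring
  have e5 : tau N (g * miwa P * miwa Q * miwa (-Q)) = tau N (g * miwa P) := by
    rw [← tau_miwa_neg N Q (g * miwa P)]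
    congr 1
    ring
  rw [e1, e2, e3, e4, e5] at h
  linear_combination -h

end MiwaQuotient

/-! ### Confluent relations for the quotient polynomial -/

section Quotients

open PowerSeries

variable {N : ℕ} {g : ℂ⟦X⟧} {x : ℂ}

/-- Cancels a linear factor before evaluation at its own root, replacing a limit y → c. -/
theorem polynomial_eq_of_sub_mul_eval {A B : Polynomial ℂ} (c : ℂ)
    (h : ∀ y, (y - c) * A.eval y = (y - c) * B.eval y) : A = B := by
  have h1 : (Polynomial.X - Polynomial.C c) * A = (Polynomial.X - Polynomial.C c) * B :=
    Polynomial.funext fun y => by simpa using h y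
  exact mul_left_cancel₀ (Polynomial.X_sub_C_ne_zero c) h1

/-- The bilinear identity at x, y, -x, -y, divided by y - x; the division is possible because (x+y)²
- 4xy = (x-y)². -/
theorem miwaQuot_relation (N : ℕ) (g : ℂ⟦X⟧) (x y : ℂ) :
    (x + y) ^ 2 * tau N g * ((miwaQuot N g (-x)).eval y - (miwaQuot N g x).eval (-y))
      = (x - y) * (tau N (g * (miwa x * miwa y)) * tau N (g * (miwa (-x) * miwa (-y)))
        - tau N g ^ 2 + (x + y) ^ 2 * (miwaQuot N g x).eval (-y) * (miwaQuot N g (-x)).eval y) := by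
  set A := (miwaQuot N g (-x)) with hA
  set B := (miwaQuot N g x).comp (-Polynomial.X) with hB
  set T := miwaPoly N g x with hT
  set T' := (miwaPoly N g (-x)).comp (-Polynomial.X) with hT'
  set c : Polynomial ℂ := Polynomial.C x with hc
  have key : (c + Polynomial.X) ^ 2 * Polynomial.C (tau N g) * (A - B)
      = (c - Polynomial.X) * (T * T' - Polynomial.C (tau N g) ^ 2
        + (c + Polynomial.X) ^ 2 * B * A) := by
    refine polynomial_eq_of_sub_mul_eval x fun z => ?_
    simp only [hA, hB, hT, hT', hc, Polynomial.eval_mul, Polynomial.eval_add, Polynomial.eval_sub,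
      Polynomial.eval_pow, Polynomial.eval_C, Polynomial.eval_X, Polynomial.eval_comp,
      Polynomial.eval_neg, eval_miwaPoly]
    have h := tau_bilinear N g x z (-x) (-z)
    have e1 := tau_mul_miwa N g x (-z)
    have e2 := tau_mul_miwa N g (-x) z
    rw [tau_miwa_neg, tau_miwa_neg, e1, mul_comm (miwa z), e2] at h
    linear_combination -h
  have := congrArg (Polynomial.eval y) key
  simpa only [hA, hB, hT, hT', hc, Polynomial.eval_mul, Polynomial.eval_add, Polynomial.eval_sub,
      Polynomial.eval_pow, Polynomial.eval_C, Polynomial.eval_X, Polynomial.eval_comp,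
      Polynomial.eval_neg, eval_miwaPoly] using this

theorem miwaQuot_symm (ht : tau N g ≠ 0) (hx : x ≠ 0) :
    (miwaQuot N g (-x)).eval x = (miwaQuot N g x).eval (-x) := by
  have h := miwaQuot_relation N g x x
  rw [sub_self, zero_mul] at h
  have h2 : (x + x) ^ 2 * tau N g ≠ 0 :=
    mul_ne_zero (pow_ne_zero _ (by simpa [← two_mul] using hx)) ht
  exact sub_eq_zero.1 ((mul_eq_zero.1 h).resolve_left h2)

/-- The y-derivative of `miwaQuot_relation` at y = x: on the left the difference vanishes there by
symmetry, on the right only the derivative of x - y survives. This converts the sum of the two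
U-terms into a product of tau functions. -/
theorem miwaQuot_derivative (ht : tau N g ≠ 0) (hx : x ≠ 0) :
    4 * x ^ 2 * tau N g * ((miwaQuot N g (-x)).derivative.eval x
        + (miwaQuot N g x).derivative.eval (-x))
      = -(tau N (g * (miwa x * miwa x)) * tau N (g * (miwa (-x) * miwa (-x))) - tau N g ^ 2
        + 4 * x ^ 2 * (miwaQuot N g x).eval (-x) ^ 2) := by
  set A := (miwaQuot N g (-x)) with hA
  set B := (miwaQuot N g x).comp (-Polynomial.X) with hB
  set T := miwaPoly N g x with hT
  set T' := (miwaPoly N g (-x)).comp (-Polynomial.X) with hT'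
  set c : Polynomial ℂ := Polynomial.C x with hc
  have key : (c + Polynomial.X) ^ 2 * Polynomial.C (tau N g) * (A - B)
      = (c - Polynomial.X) * (T * T' - Polynomial.C (tau N g) ^ 2
        + (c + Polynomial.X) ^ 2 * B * A) := by
    refine Polynomial.funext fun z => ?_
    simpa only [hA, hB, hT, hT', hc, Polynomial.eval_mul, Polynomial.eval_add, Polynomial.eval_sub,
      Polynomial.eval_pow, Polynomial.eval_C, Polynomial.eval_X, Polynomial.eval_comp,
      Polynomial.eval_neg, eval_miwaPoly] using miwaQuot_relation N g x z
  have h := congrArg (fun p => Polynomial.eval x (Polynomial.derivative p)) key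
  have hs := miwaQuot_symm ht hx
  simp only [hB, hT, hT', hc, Polynomial.derivative_mul, Polynomial.derivative_sub,
    Polynomial.derivative_add, Polynomial.derivative_C, Polynomial.derivative_X,
    Polynomial.derivative_neg,
    Polynomial.derivative_comp, Polynomial.eval_mul, Polynomial.eval_add, Polynomial.eval_sub,
    Polynomial.eval_pow, Polynomial.eval_C, Polynomial.eval_X, Polynomial.eval_comp,
    Polynomial.eval_neg, eval_miwaPoly, Polynomial.eval_one, Polynomial.eval_zero] at h
  rw [← hA] at hs
  rw [hs] at h
  linear_combination h

theorem miwaQuot_shift (N : ℕ) (g : ℂ⟦X⟧) (x P : ℂ) :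
    P * tau N g * tau N (g * miwa P)
      - x * (x + P) * (miwaQuot N (g * miwa P) x).eval (-x) * tau N g
      + x * (x + P) * (miwaQuot N g x).eval (-x) * tau N (g * miwa P)
      = P * tau N (g * miwa (-x)) * tau N (g * miwa P * miwa x) := by
  have hT : ∀ z, (miwaPoly N g 0).eval z = tau N (g * miwa z) := by
    intro z
    rw [eval_miwaPoly, miwa_zero, one_mul]
  have key : Polynomial.C (P * tau N g * tau N (g * miwa P))
      + Polynomial.C x * (Polynomial.X - Polynomial.C P) * miwaQuot N (g * miwa P) x
        * Polynomial.C (tau N g)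
      - Polynomial.X * Polynomial.C (P + x) * miwaQuot N g x * Polynomial.C (tau N (g * miwa P))
      = Polynomial.C (P * tau N (g * miwa P * miwa x)) * miwaPoly N g 0 := by
    refine polynomial_eq_of_sub_mul_eval (-x) fun z => ?_
    simp only [Polynomial.eval_mul, Polynomial.eval_add, Polynomial.eval_sub,
      Polynomial.eval_C, Polynomial.eval_X, hT]
    have h := tau_shift N g x z P
    rw [tau_mul_miwa, tau_mul_miwa] at h
    linear_combination h
  have := congrArg (Polynomial.eval (-x)) key
  simp only [Polynomial.eval_mul, Polynomial.eval_add, Polynomial.eval_sub,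
      Polynomial.eval_C, Polynomial.eval_X, hT] at this
  linear_combination this

end Quotients

/-! ### From Casoratians to the tau function -/

section Taylor

open PowerSeries

/-- The Taylor series at `0`. -/
def taylorSeries (f : ℂ → ℂ) : ℂ⟦X⟧ :=
  PowerSeries.mk fun k => iteratedDeriv k f 0 / (k.factorial : ℂ)

theorem taylorSeries_congr {f g : ℂ → ℂ} (h : f =ᶠ[𝓝 0] g) : taylorSeries f = taylorSeries g := by
  ext k
  simp [taylorSeries, h.iteratedDeriv_eq]

theorem taylorSeries_mul {f g : ℂ → ℂ} (hf : AnalyticAt ℂ f 0) (hg : AnalyticAt ℂ g 0) :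
    taylorSeries (fun k => f k * g k) = taylorSeries f * taylorSeries g := by
  ext k
  have h := iteratedDeriv_mul (n := k) (hf.contDiffAt) (hg.contDiffAt)
  have e : (fun k => f k * g k) = f * g := rfl
  rw [coeff_mul, taylorSeries, coeff_mk, e, h, Finset.Nat.sum_antidiagonal_eq_sum_range_succ
    (fun i j => coeff i (taylorSeries f) * coeff j (taylorSeries g)), Finset.sum_div]
  refine Finset.sum_congr rfl fun i hi => ?_
  simp only [taylorSeries, coeff_mk]
  rw [Nat.cast_choose ℂ (Nat.lt_succ_iff.1 (Finset.mem_range.1 hi))]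
  have := Nat.factorial_ne_zero k
  field_simp

theorem taylorSeries_const_add (a : ℂ) : taylorSeries (fun k => a + k) = C a + X := by
  ext k
  simp only [taylorSeries, coeff_mk]
  have h : deriv (fun k : ℂ => a + k) = fun _ => 1 := by
    ext z
    simp
  rcases k with _ | _ | k
  · simp
  · simp [iteratedDeriv_succ', h, coeff_one_X]
  · rw [iteratedDeriv_succ', h, iteratedDeriv_succ']
    simp [coeff_X]

theorem analyticAt_add_zpow {a : ℂ} (ha : a ≠ 0) (n : ℤ) :
    AnalyticAt ℂ (fun k : ℂ => (a + k) ^ n) 0 :=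
  (analyticAt_const.add analyticAt_id).zpow (by simpa using ha)

theorem eventually_add_ne_zero {a : ℂ} (ha : a ≠ 0) : ∀ᶠ k : ℂ in 𝓝 0, a + k ≠ 0 :=
  (continuousAt_const.add continuousAt_id).eventually_ne (by simpa using ha)

theorem taylorSeries_zpow_add {a : ℂ} (ha : a ≠ 0) (n m : ℤ) :
    taylorSeries (fun k => (a + k) ^ (n + m))
      = taylorSeries (fun k => (a + k) ^ n) * taylorSeries (fun k => (a + k) ^ m) := by
  rw [← taylorSeries_mul (analyticAt_add_zpow ha n) (analyticAt_add_zpow ha m)]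
  refine taylorSeries_congr ?_
  filter_upwards [eventually_add_ne_zero ha] with k hk
  exact zpow_add₀ hk n m

theorem taylorSeries_zpow_succ {a : ℂ} (ha : a ≠ 0) (n : ℤ) :
    taylorSeries (fun k => (a + k) ^ (n + 1))
      = taylorSeries (fun k => (a + k) ^ n) * (C a + X) := by
  rw [taylorSeries_zpow_add ha, ← taylorSeries_const_add]
  simp

theorem taylorSeries_zpow_zero (a : ℂ) : taylorSeries (fun k => (a + k) ^ (0 : ℤ)) = 1 := by
  ext k
  simp only [taylorSeries, coeff_mk, zpow_zero, coeff_one]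
  rcases k with _ | k
  · simp
  · simp [iteratedDeriv_const]

theorem coeff_taylorSeries_zpow (a : ℂ) (n : ℤ) (j : ℕ) :
    coeff j (taylorSeries (fun k => (a + k) ^ n))
      = (∏ i ∈ Finset.range j, ((n : ℂ) - i)) * a ^ (n - j) / j.factorial := by
  rw [taylorSeries, coeff_mk, iteratedDeriv_comp_const_add j (fun z : ℂ => z ^ n) a,
    iteratedDeriv_eq_iterate]
  simp only [iter_deriv_zpow, add_zero]

theorem analyticAt_halfPow {c : ℂ} (hc : c ≠ 0) (l : ℕ) : AnalyticAt ℂ (halfPow c l) 0 := by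
  unfold halfPow
  refine analyticAt_const.mul (AnalyticAt.cpow (analyticAt_const.add (analyticAt_id.div
    analyticAt_const hc)) analyticAt_const ?_)
  simp

theorem halfPow_succ {c : ℂ} (hc : c ≠ 0) (l : ℕ) :
    halfPow c (l + 1) =ᶠ[𝓝 0] fun k => halfPow c l k * (c + k) := by
  filter_upwards [eventually_add_ne_zero hc] with k hk
  have h : 1 + k / c ≠ 0 := by
    intro h
    apply hk
    have e : c + k = c * (1 + k / c) := by field_simp
    rw [e, h, mul_zero]
  have e : (((l + 1 : ℕ) : ℂ) + 1 / 2) = ((l : ℂ) + 1 / 2) + 1 := by push_cast; ring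
  rw [halfPow, halfPow, e, Complex.cpow_add _ _ hc, Complex.cpow_add _ _ h, Complex.cpow_one,
    Complex.cpow_one]
  field_simp

theorem taylorSeries_halfPow {c : ℂ} (hc : c ≠ 0) (l : ℕ) :
    taylorSeries (halfPow c l) = taylorSeries (halfPow c 0) * (C c + X) ^ l := by
  induction l with
  | zero => simp
  | succ l ih =>
    rw [taylorSeries_congr (halfPow_succ hc l), taylorSeries_mul (g := fun k => c + k)
      (analyticAt_halfPow hc l) (analyticAt_const.add analyticAt_id), ih, taylorSeries_const_add, pow_succ, mul_assoc]

/-- The Taylor series of `(p + k) ^ n (q + k) ^ m (c + k) ^ (1 / 2)`. -/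
def waveSeries (p q c : ℂ) (n m : ℤ) : ℂ⟦X⟧ :=
  taylorSeries (fun k => (p + k) ^ n) * taylorSeries (fun k => (q + k) ^ m)
    * taylorSeries (halfPow c 0)

theorem nqcPhi_neg (p q a b c : ℂ) (s : ℕ) (n m α β : ℤ) (l : ℕ) :
    nqcPhi p q a b c (-1) s n m α β l = nqcPhi p q a b c 1 s n m α β l := by
  unfold nqcPhi
  congr 1
  have h := iteratedDeriv_comp_neg (2 * s) (fun k : ℂ => (p + 1 * k) ^ n * (q + 1 * k) ^ m
    * (a + 1 * k) ^ α * (b + 1 * k) ^ β * halfPow c l (1 * k)) 0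
  simp only [neg_zero, pow_mul, neg_one_sq, one_pow, one_smul] at h
  rw [← h]
  simp

theorem nqcPhi_eq_coeff {p q a b c : ℂ} (hp : p ≠ 0) (hq : q ≠ 0) (ha : a ≠ 0) (hb : b ≠ 0)
    (hc : c ≠ 0) (s : ℕ) (n m α β : ℤ) (l : ℕ) :
    nqcPhi p q a b c 1 s n m α β l
      = coeff (2 * s) (waveSeries p q c n m * taylorSeries (fun k => (a + k) ^ α)
        * taylorSeries (fun k => (b + k) ^ β) * (C c + X) ^ l) := by
  have h : waveSeries p q c n m * taylorSeries (fun k => (a + k) ^ α)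
        * taylorSeries (fun k => (b + k) ^ β) * (C c + X) ^ l
      = taylorSeries (fun k => (p + k) ^ n * (q + k) ^ m * (a + k) ^ α * (b + k) ^ β
          * halfPow c l k) := by
    have h1 := analyticAt_add_zpow hp n
    have h2 := analyticAt_add_zpow hq m
    have h3 := analyticAt_add_zpow ha α
    have h4 := analyticAt_add_zpow hb β
    rw [taylorSeries_mul (f := fun k => (p + k) ^ n * (q + k) ^ m * (a + k) ^ α * (b + k) ^ β)
        (((h1.mul h2).mul h3).mul h4) (analyticAt_halfPow hc l),
      taylorSeries_mul (f := fun k => (p + k) ^ n * (q + k) ^ m * (a + k) ^ α)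
        ((h1.mul h2).mul h3) h4,
      taylorSeries_mul (f := fun k => (p + k) ^ n * (q + k) ^ m) (h1.mul h2) h3,
      taylorSeries_mul h1 h2, taylorSeries_halfPow hc, waveSeries]
    ring
  rw [h, taylorSeries, coeff_mk, nqcPhi]
  simp

/-- Expanding (c+X)^l binomially is a unipotent column operation, so the column index may be carried
by X^l alone. -/
theorem tau_eq_det_add_pow (N : ℕ) (c : ℂ) (H : ℂ⟦X⟧) :
    Matrix.det (Matrix.of fun i l : Fin N => coeff (2 * (i : ℕ)) (H * (C c + X) ^ (l : ℕ)))
      = tau N H := by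
  have hU : (Matrix.of fun k l : Fin N => c ^ ((l : ℕ) - k) * ((l : ℕ).choose k : ℂ)).det = 1 := by
    rw [Matrix.det_of_isUpperTriangular]
    · simp
    · intro i j hij
      have : (j : ℕ) < i := hij
      simp [Nat.choose_eq_zero_of_lt this]
  rw [tau]
  conv_rhs => rw [← mul_one (Matrix.det _), ← hU, ← Matrix.det_mul]
  congr 1
  ext i l
  simp only [Matrix.of_apply, Matrix.mul_apply]
  have h : H * (C c + X) ^ (l : ℕ)
      = ∑ k : Fin N, C (c ^ ((l : ℕ) - k) * ((l : ℕ).choose k : ℂ)) * (H * X ^ (k : ℕ)) := by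
    rw [add_comm, add_pow, Finset.mul_sum, Fin.sum_univ_eq_sum_range
      (fun k => C (c ^ ((l : ℕ) - k) * ((l : ℕ).choose k : ℂ)) * (H * X ^ k)) N]
    refine Finset.sum_subset_zero_on_sdiff (by simp) ?_ ?_
    · intro k hk
      simp only [Finset.mem_sdiff, Finset.mem_range, not_lt] at hk
      simp [Nat.choose_eq_zero_of_lt (show (l : ℕ) < k by omega)]
    · intro k _
      simp only [map_mul, map_pow, map_natCast]
      ring
  rw [h, map_sum]
  exact Finset.sum_congr rfl fun k _ => by rw [coeff_C_mul, mul_comm]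

variable {N : ℕ} {p q a b c : ℂ} (Ap Am : Matrix (Fin N) (Fin N) ℂ)

theorem casoratian_eq_tau (hp : p ≠ 0) (hq : q ≠ 0) (ha : a ≠ 0) (hb : b ≠ 0) (hc : c ≠ 0)
    (n m α β : ℤ) :
    casoratian p q c Ap Am a b n m α β
      = (Ap + Am).det * tau N (waveSeries p q c n m * taylorSeries (fun k => (a + k) ^ α)
        * taylorSeries (fun k => (b + k) ^ β)) := by
  rw [casoratian, ← tau_eq_det_add_pow N c, ← Matrix.det_mul]
  congr 1
  ext i l
  simp only [nqcVec, nqcPhi_neg, ← Matrix.add_mulVec, nqcPhi_eq_coeff hp hq ha hb hc]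
  rfl

theorem nqcF_eq_tau (hp : p ≠ 0) (hq : q ≠ 0) (hc : c ≠ 0) (n m : ℤ) :
    nqcF p q c Ap Am n m = (Ap + Am).det * tau N (waveSeries p q c n m) := by
  rw [nqcF, casoratian_eq_tau Ap Am hp hq one_ne_zero one_ne_zero hc, taylorSeries_zpow_zero,
    mul_one, mul_one]

/-- The two sides differ by the even factors a² - X² and b² - X², because (a² - X²)/(a + X) = a - X.
-/
theorem tau_mul_inverses (ha : a ≠ 0) (hb : b ≠ 0) (g : ℂ⟦X⟧) :
    (a * b) ^ N * tau N (g * taylorSeries (fun k => (a + k) ^ (-1 : ℤ))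
        * taylorSeries (fun k => (b + k) ^ (-1 : ℤ)))
      = tau N (g * (miwa (1 / a) * miwa (1 / b))) := by
  have hab : (a * b) ^ N ≠ 0 := pow_ne_zero _ (mul_ne_zero ha hb)
  have h1 : taylorSeries (fun k => (a + k) ^ (-1 : ℤ)) * (C a + X) = 1 := by
    rw [← taylorSeries_zpow_succ ha, neg_add_cancel, taylorSeries_zpow_zero]
  have h2 : taylorSeries (fun k => (b + k) ^ (-1 : ℤ)) * (C b + X) = 1 := by
    rw [← taylorSeries_zpow_succ hb, neg_add_cancel, taylorSeries_zpow_zero]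
  have h3 : C a * miwa (1 / a) = C a - X := by
    rw [miwa, mul_sub, ← mul_assoc, ← map_mul, mul_one_div_cancel ha, map_one, mul_one, one_mul]
  have h4 : C b * miwa (1 / b) = C b - X := by
    rw [miwa, mul_sub, ← mul_assoc, ← map_mul, mul_one_div_cancel hb, map_one, mul_one, one_mul]
  generalize taylorSeries (fun k => (a + k) ^ (-1 : ℤ)) = A at *
  generalize taylorSeries (fun k => (b + k) ^ (-1 : ℤ)) = B at *
  apply mul_left_cancel₀ hab
  rw [← tau_C_mul N (a * b) (g * (miwa (1 / a) * miwa (1 / b)))]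
  have h5 : C (a * b) * (g * (miwa (1 / a) * miwa (1 / b)))
      = (C (a ^ 2) + C (-1) * X ^ 2) * ((C (b ^ 2) + C (-1) * X ^ 2) * (g * A * B)) := by
    rw [map_mul]
    have : C a * C b * (g * (miwa (1 / a) * miwa (1 / b)))
      = g * ((C a * miwa (1 / a)) * (C b * miwa (1 / b))) * (A * (C a + X)) * (B * (C b + X)) := by
      rw [h1, h2]; ring
    rw [this, h3, h4, map_pow, map_pow, map_neg, map_one]
    ring
  rw [h5, tau_even_mul, tau_even_mul]
  ring

theorem nqcTheta_eq (hp : p ≠ 0) (hq : q ≠ 0) (hc : c ≠ 0) (ha : a ≠ 0) (hb : b ≠ 0)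
    (hab : a + b ≠ 0) (n m : ℤ) :
    nqcTheta p q c Ap Am a b n m = (Ap + Am).det * (1 / a * (1 / b) *
      (miwaQuot N (waveSeries p q c n m) (1 / a)).eval (1 / b)) := by
  rw [nqcTheta, nqcF_eq_tau Ap Am hp hq hc, casoratian_eq_tau Ap Am hp hq ha hb hc]
  have h := tau_mul_inverses (N := N) ha hb (waveSeries p q c n m)
  rw [tau_mul_miwa] at h
  have e : ∀ A B C D : ℂ, -(1 / (a + b)) * (A * (B * C) - B * D)
      = -(1 / (a + b)) * (B * (A * C) - B * D) := by intros; ring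
  rw [e, h]
  field_simp
  ring

/-- The common factor `(Ap + Am).det` cancels. The formula is continuous in b ≠ 0, so it also gives
the limit defining S(a,-a). -/
theorem nqcS_eq (hp : p ≠ 0) (hq : q ≠ 0) (hc : c ≠ 0) (ha : a ≠ 0) (hb : b ≠ 0) {n m : ℤ}
    (hf : nqcF p q c Ap Am n m ≠ 0) :
    nqcS p q c Ap Am n m a b = 1 / a * (1 / b) *
      (miwaQuot N (waveSeries p q c n m) (1 / a)).eval (1 / b)
        / tau N (waveSeries p q c n m) := by
  have hf' := hf
  rw [nqcF_eq_tau Ap Am hp hq hc] at hf'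
  have key : ∀ b' : ℂ, b' ≠ 0 → a + b' ≠ 0 →
      nqcTheta p q c Ap Am a b' n m / nqcF p q c Ap Am n m = 1 / a * (1 / b') *
      (miwaQuot N (waveSeries p q c n m) (1 / a)).eval (1 / b')
        / tau N (waveSeries p q c n m) := by
    intro b' hb' hab
    rw [nqcTheta_eq Ap Am hp hq hc ha hb' hab, nqcF_eq_tau Ap Am hp hq hc,
      mul_div_mul_left _ _ (left_ne_zero_of_mul hf')]
  unfold nqcS
  split_ifs with hab
  · refine Tendsto.limUnder_eq ?_
    have hcont : ContinuousAt (fun b' : ℂ => 1 / a * (1 / b') *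
      (miwaQuot N (waveSeries p q c n m) (1 / a)).eval (1 / b')
        / tau N (waveSeries p q c n m)) b := by
      have h1 : ContinuousAt (fun b' : ℂ => 1 / b') b := continuousAt_const.div continuousAt_id hb
      exact ((continuousAt_const.mul h1).mul
        ((miwaQuot N (waveSeries p q c n m) (1 / a)).continuous.continuousAt.comp h1)).div_const _
    refine (hcont.tendsto.mono_left nhdsWithin_le_nhds).congr' ?_
    filter_upwards [self_mem_nhdsWithin, nhdsWithin_le_nhds (continuousAt_id.eventually_ne hb)]
      with b' h1 h2
    refine (key b' h2 ?_).symm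
    intro h
    exact h1 (by
      simp only [Set.mem_singleton_iff]
      linear_combination h - hab)
  · exact key b hb hab

end Taylor

/-! ### Evolution of the tau ratios and the Q2 equation for `solForm` -/

section Relations

open PowerSeries

/-- The ratio `tau N (g * miwa x) / tau N g`. -/
def tauRatio (N : ℕ) (g : ℂ⟦X⟧) (x : ℂ) : ℂ := tau N (g * miwa x) / tau N g

/-- The ratio `tau N (g * (miwa x * miwa x)) / tau N g`. -/
def tauRatioSq (N : ℕ) (g : ℂ⟦X⟧) (x : ℂ) : ℂ := tau N (g * (miwa x * miwa x)) / tau N g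

/-- The value at `-x` of the quotient `miwaQuot N g x`, divided by `tau N g`. -/
def quotRatio (N : ℕ) (g : ℂ⟦X⟧) (x : ℂ) : ℂ := (miwaQuot N g x).eval (-x) / tau N g

variable {N : ℕ}

theorem miwaQuot_C_mul (d : ℂ) (g : ℂ⟦X⟧) (x : ℂ) :
    miwaQuot N (C d * g) x = Polynomial.C (d ^ N) * miwaQuot N g x := by
  refine polynomial_eq_of_sub_mul_eval (-x) fun y => ?_
  have h1 := tau_mul_miwa N (C d * g) x y
  have h2 := tau_mul_miwa N g x y
  rw [mul_assoc, tau_C_mul, tau_C_mul] at h1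
  rw [Polynomial.eval_mul, Polynomial.eval_C]
  linear_combination h1 - d ^ N * h2

variable {d : ℂ} {g : ℂ⟦X⟧} {x : ℂ}

theorem tauRatioSq_C_mul (hd : d ≠ 0) : tauRatioSq N (C d * g) x = tauRatioSq N g x := by
  rw [tauRatioSq, tauRatioSq, mul_assoc, tau_C_mul, tau_C_mul,
    mul_div_mul_left _ _ (pow_ne_zero N hd)]

theorem quotRatio_C_mul (hd : d ≠ 0) : quotRatio N (C d * g) x = quotRatio N g x := by
  rw [quotRatio, quotRatio, miwaQuot_C_mul, tau_C_mul, Polynomial.eval_mul, Polynomial.eval_C,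
    mul_div_mul_left _ _ (pow_ne_zero N hd)]

theorem quotRatio_neg (ht : tau N g ≠ 0) (hx : x ≠ 0) : quotRatio N g (-x) = quotRatio N g x := by
  rw [quotRatio, quotRatio, neg_neg, miwaQuot_symm ht hx]

variable {p q a : ℂ}

theorem tauRatioSq_shift (hp : p ≠ 0) (ha : a ≠ 0) (ht : tau N g ≠ 0)
    (htp : tau N (g * miwa (-1 / p)) ≠ 0) :
    (p + a) * tauRatioSq N (g * miwa (-1 / p)) (1 / a) - (p - a) * tauRatioSq N g (1 / a)
      = 2 * a * tauRatio N (g * miwa (-1 / p)) (1 / a) * tauRatio N g (1 / a) := by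
  have h := tau_shift N g (1 / a) (1 / a) (-1 / p)
  unfold tauRatioSq tauRatio
  generalize tau N (g * miwa (-1 / p)) = t1 at *
  generalize tau N g = t0 at *
  field_simp
  field_simp at h
  linear_combination -h

theorem quotRatio_shift (hp : p ≠ 0) (ha : a ≠ 0) (ht : tau N g ≠ 0)
    (htp : tau N (g * miwa (-1 / p)) ≠ 0) :
    1 - (a - p) * (1 / a) ^ 2
        * (quotRatio N (g * miwa (-1 / p)) (1 / a) - quotRatio N g (1 / a))
      = tauRatio N (g * miwa (-1 / p)) (1 / a) * tauRatio N g (-(1 / a)) := by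
  have h := miwaQuot_shift N g (1 / a) (-1 / p)
  unfold quotRatio tauRatio
  generalize tau N (g * miwa (-1 / p)) = t1 at *
  generalize tau N g = t0 at *
  generalize (miwaQuot N g (1 / a)).eval (-(1 / a)) = w0 at *
  generalize (miwaQuot N (g * miwa (-1 / p)) (1 / a)).eval (-(1 / a)) = w1 at *
  generalize tau N (g * miwa (-(1 / a))) = s0 at *
  generalize tau N (g * miwa (-1 / p) * miwa (1 / a)) = s1 at *
  field_simp
  field_simp at h
  linear_combination -h

theorem tauRatio_cross (hp : p ≠ 0) (hq : q ≠ 0) (ha : a ≠ 0) (ht : tau N g ≠ 0)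
    (htp : tau N (g * miwa (-1 / p)) ≠ 0) (htq : tau N (g * miwa (-1 / q)) ≠ 0) :
    (p - q) * (tau N (g * miwa (-1 / p) * miwa (-1 / q)) * tau N g
        / (tau N (g * miwa (-1 / p)) * tau N (g * miwa (-1 / q)))) * tauRatio N g (1 / a)
      = (p + a) * tauRatio N (g * miwa (-1 / p)) (1 / a)
        - (q + a) * tauRatio N (g * miwa (-1 / q)) (1 / a) := by
  have h := tau_cross N g (1 / a) (-1 / p) (-1 / q)
  unfold tauRatio
  generalize tau N (g * miwa (-1 / p) * miwa (1 / a)) = s1 at *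
  generalize tau N (g * miwa (-1 / q) * miwa (1 / a)) = s2 at *
  generalize tau N (g * miwa (-1 / p) * miwa (-1 / q)) = t3 at *
  generalize tau N (g * miwa (-1 / p)) = t1 at *
  generalize tau N (g * miwa (-1 / q)) = t2 at *
  generalize tau N g = t0 at *
  field_simp
  field_simp at h
  linear_combination h

theorem tauRatio_cross' (hp : p ≠ 0) (hq : q ≠ 0) (ha : a ≠ 0)
    (htp : tau N (g * miwa (-1 / p)) ≠ 0) (htq : tau N (g * miwa (-1 / q)) ≠ 0)
    (htpq : tau N (g * miwa (-1 / p) * miwa (-1 / q)) ≠ 0) :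
    (p - q) * (tau N (g * miwa (-1 / p) * miwa (-1 / q)) * tau N g
        / (tau N (g * miwa (-1 / p)) * tau N (g * miwa (-1 / q))))
        * tauRatio N (g * miwa (-1 / p) * miwa (-1 / q)) (1 / a)
      = (p - a) * tauRatio N (g * miwa (-1 / q)) (1 / a)
        - (q - a) * tauRatio N (g * miwa (-1 / p)) (1 / a) := by
  have h := tau_cross' N g (1 / a) (-1 / p) (-1 / q)
  unfold tauRatio
  generalize tau N (g * miwa (-1 / p) * miwa (-1 / q) * miwa (1 / a)) = s3 at *
  generalize tau N (g * miwa (-1 / p) * miwa (1 / a)) = s1 at *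
  generalize tau N (g * miwa (-1 / q) * miwa (1 / a)) = s2 at *
  generalize tau N (g * miwa (-1 / p) * miwa (-1 / q)) = t3 at *
  generalize tau N (g * miwa (-1 / p)) = t1 at *
  generalize tau N (g * miwa (-1 / q)) = t2 at *
  generalize tau N g = t0 at *
  field_simp
  field_simp at h
  linear_combination h

/-- The factorized form of the solution of Q2. -/
def solForm (N : ℕ) (g : ℂ⟦X⟧) (a ξ r E F : ℂ) : ℂ :=
  ((ξ - 2 / a * quotRatio N g (1 / a)) ^ 2
    + (r * tauRatioSq N g (1 / a) + E) * (r⁻¹ * tauRatioSq N g (-(1 / a)) + F)) / 4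

theorem solForm_C_mul (hd : d ≠ 0) (ξ r E F : ℂ) :
    solForm N (C d * g) a ξ r E F = solForm N g a ξ r E F := by
  rw [solForm, solForm, quotRatio_C_mul hd, tauRatioSq_C_mul hd, tauRatioSq_C_mul hd]

/-- Absorbs the plane wave factor at the base point into the constants, so the square can be treated
with r = 1 there. -/
theorem solForm_mul (s : ℂ) {r : ℂ} (hr : r ≠ 0) (ξ E F : ℂ) :
    solForm N g a ξ (s * r) E F = solForm N g a ξ s (E / r) (F * r) := by
  unfold solForm
  field_simp

/-- The edge data of `solForm` under a shift. -/
theorem edge_shift (hp : p ≠ 0) (ha : a ≠ 0) (hpa : p - a ≠ 0) (hpa' : p + a ≠ 0)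
    (ht : tau N g ≠ 0) (htp : tau N (g * miwa (-1 / p)) ≠ 0) :
    (2 * a * p / (a ^ 2 - p ^ 2) - 2 / a * quotRatio N (g * miwa (-1 / p)) (1 / a)
      = -(2 / a * quotRatio N g (1 / a))
        - a * (tauRatio N (g * miwa (-1 / p)) (1 / a) * tauRatio N g (-(1 / a)) / (p - a)
          + tauRatio N (g * miwa (-1 / p)) (-(1 / a)) * tauRatio N g (1 / a) / (p + a))) ∧
    ((p + a) / (p - a) * tauRatioSq N (g * miwa (-1 / p)) (1 / a) = tauRatioSq N g (1 / a)
      + 2 * a * tauRatio N (g * miwa (-1 / p)) (1 / a) * tauRatio N g (1 / a) / (p - a)) ∧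
    ((p - a) / (p + a) * tauRatioSq N (g * miwa (-1 / p)) (-(1 / a)) = tauRatioSq N g (-(1 / a))
      - 2 * a * tauRatio N (g * miwa (-1 / p)) (-(1 / a)) * tauRatio N g (-(1 / a))
        / (p + a)) ∧
    (p + a) * tauRatio N (g * miwa (-1 / p)) (1 / a) * tauRatio N g (-(1 / a))
      - (p - a) * tauRatio N (g * miwa (-1 / p)) (-(1 / a)) * tauRatio N g (1 / a) = 2 * a := by
  have hna : -a ≠ 0 := neg_ne_zero.2 ha
  have hx : (1 / a) ≠ 0 := one_div_ne_zero ha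
  have e : 1 / (-a) = -(1 / a) := by rw [div_neg]
  have h1 := tauRatioSq_shift hp ha ht htp
  have h2 := tauRatioSq_shift hp hna ht htp
  have h3 := quotRatio_shift hp ha ht htp
  have h4 := quotRatio_shift hp hna ht htp
  rw [e] at h2 h4
  rw [quotRatio_neg ht hx, quotRatio_neg htp hx, neg_neg] at h4
  generalize quotRatio N (g * miwa (-1 / p)) (1 / a) = k1 at *
  generalize quotRatio N g (1 / a) = k0 at *
  have h5 : a ^ 2 - p ^ 2 = -((p - a) * (p + a)) := by ring
  generalize g * miwa (-1 / p) = g' at *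
  refine ⟨?_, ?_, ?_, ?_⟩
  · rw [← h3, ← h4, h5]
    field_simp
    ring
  · field_simp
    linear_combination h1
  · field_simp
    linear_combination h2
  · linear_combination -(p + a) * h3 + (p - a) * h4

/-- The cross relations express v, w, v₂, w₂ through the values at the two intermediate corners,
with common denominator H. Only those four values, R, X, Y and the parameters then remain, subject
to the single constraint `hW`. -/
theorem solForm_quad (hp : p ≠ 0) (hq : q ≠ 0) (ha : a ≠ 0) (hpa : p - a ≠ 0) (hpa' : p + a ≠ 0)
    (hqa : q - a ≠ 0) (hqa' : q + a ≠ 0) (hpq : p - q ≠ 0)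
    (ht : tau N g ≠ 0) (htp : tau N (g * miwa (-1 / p)) ≠ 0)
    (htq : tau N (g * miwa (-1 / q)) ≠ 0)
    (htpq : tau N (g * miwa (-1 / p) * miwa (-1 / q)) ≠ 0) (ξ E F : ℂ) :
    Q2Eq (a ^ 2 / (p ^ 2 - a ^ 2)) (a ^ 2 / (q ^ 2 - a ^ 2))
      (solForm N g a ξ 1 E F)
      (solForm N (g * miwa (-1 / p)) a (ξ + 2 * a * p / (a ^ 2 - p ^ 2)) ((p + a) / (p - a)) E F)
      (solForm N (g * miwa (-1 / q)) a (ξ + 2 * a * q / (a ^ 2 - q ^ 2)) ((q + a) / (q - a)) E F)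
      (solForm N (g * miwa (-1 / p) * miwa (-1 / q)) a
        (ξ + 2 * a * p / (a ^ 2 - p ^ 2) + 2 * a * q / (a ^ 2 - q ^ 2))
        ((p + a) / (p - a) * ((q + a) / (q - a))) E F) := by
  have hna : -a ≠ 0 := neg_ne_zero.2 ha
  have e : 1 / (-a) = -(1 / a) := by rw [div_neg]
  obtain ⟨p1, p2, p3, p4⟩ := edge_shift hp ha hpa hpa' ht htp
  obtain ⟨q1, q2, q3, q4⟩ := edge_shift hq ha hqa hqa' ht htq
  obtain ⟨r1, r2, r3, r4⟩ := edge_shift hq ha hqa hqa' htp htpq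
  have c1 := tauRatio_cross hp hq ha ht htp htq
  have c2 := tauRatio_cross hp hq hna ht htp htq
  have c3 := tauRatio_cross' hp hq ha htp htq htpq
  have c4 := tauRatio_cross' hp hq hna htp htq htpq
  rw [e] at c2 c4
  have hH : (p - q) * (tau N (g * miwa (-1 / p) * miwa (-1 / q)) * tau N g
        / (tau N (g * miwa (-1 / p)) * tau N (g * miwa (-1 / q)))) ≠ 0 :=
    mul_ne_zero hpq (div_ne_zero (mul_ne_zero htpq ht) (mul_ne_zero htp htq))
  generalize (p - q) * (tau N (g * miwa (-1 / p) * miwa (-1 / q)) * tau N g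
        / (tau N (g * miwa (-1 / p)) * tau N (g * miwa (-1 / q)))) = H at *
  unfold solForm
  generalize tauRatio N (g * miwa (-1 / p) * miwa (-1 / q)) (1 / a) = v₂ at *
  generalize tauRatio N (g * miwa (-1 / p) * miwa (-1 / q)) (-(1 / a)) = w₂ at *
  generalize tauRatio N (g * miwa (-1 / p)) (1 / a) = vt at *
  generalize tauRatio N (g * miwa (-1 / p)) (-(1 / a)) = wt at *
  generalize tauRatio N (g * miwa (-1 / q)) (1 / a) = vh at *
  generalize tauRatio N (g * miwa (-1 / q)) (-(1 / a)) = wh at *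
  generalize tauRatio N g (1 / a) = v at *
  generalize tauRatio N g (-(1 / a)) = w at *
  generalize tauRatioSq N (g * miwa (-1 / p) * miwa (-1 / q)) (1 / a) = V₂ at *
  generalize tauRatioSq N (g * miwa (-1 / p) * miwa (-1 / q)) (-(1 / a)) = W₂ at *
  generalize tauRatioSq N (g * miwa (-1 / p)) (1 / a) = Vt at *
  generalize tauRatioSq N (g * miwa (-1 / p)) (-(1 / a)) = Wt at *
  generalize tauRatioSq N (g * miwa (-1 / q)) (1 / a) = Vh at *
  generalize tauRatioSq N (g * miwa (-1 / q)) (-(1 / a)) = Wh at *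
  generalize tauRatioSq N g (1 / a) = V at *
  generalize tauRatioSq N g (-(1 / a)) = W at *
  generalize quotRatio N (g * miwa (-1 / p) * miwa (-1 / q)) (1 / a) = Z₂ at *
  generalize quotRatio N (g * miwa (-1 / p)) (1 / a) = Zt at *
  generalize quotRatio N (g * miwa (-1 / q)) (1 / a) = Zh at *
  generalize quotRatio N g (1 / a) = Z at *
  have hv : v = ((p + a) * vt - (q + a) * vh) / H := by
    field_simp
    linear_combination c1
  have hw : w = ((p - a) * wt - (q - a) * wh) / H := by
    field_simp
    linear_combination c2
  have hv₂ : v₂ = ((p - a) * vh - (q - a) * vt) / H := by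
    field_simp
    linear_combination c3
  have hw₂ : w₂ = ((p + a) * wh - (q + a) * wt) / H := by
    field_simp
    linear_combination c4
  -- The wedge product of α = ((p+a)vt, (p-a)wt) and β = ((q+a)vh, (q-a)wh), up to sign.
  have hW : (p - a) * (q + a) * wt * vh - (p + a) * (q - a) * vt * wh = 2 * a * H := by
    linear_combination H * p4 + (p - a) * wt * c1 - (p + a) * vt * c2
  have hWq : (q - a) * (p + a) * wh * vt - (q + a) * (p - a) * vh * wt = 2 * a * (-H) := by
    linear_combination -hW
  have hvq : v = ((q + a) * vh - (p + a) * vt) / (-H) := by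
    rw [hv, div_neg, ← neg_div, neg_sub]
  have hwq : w = ((q - a) * wh - (p - a) * wt) / (-H) := by
    rw [hw, div_neg, ← neg_div, neg_sub]
  set R := ξ - 2 / a * Z with hR
  set Xv := V + E with hXv
  set Y := W + F with hY
  have i1 := edge_increment (R := R) (X := Xv) (Y := Y) ha hpa hpa' hH hW hv hw
  have i2 := edge_increment (R := R) (X := Xv) (Y := Y) ha hqa hqa' (neg_ne_zero.2 hH) hWq hvq hwq
  have i3 := face_increment (R := R) (X := Xv) (Y := Y) ha hpa hpa' hqa hqa' hH hW hv hw hv₂ hw₂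
  have hp2 : p ^ 2 - a ^ 2 ≠ 0 := by
    rw [sq_sub_sq]
    exact mul_ne_zero hpa' hpa
  have hq2 : q ^ 2 - a ^ 2 ≠ 0 := by
    rw [sq_sub_sq]
    exact mul_ne_zero hqa' hqa
  have j1 : ξ + 2 * a * p / (a ^ 2 - p ^ 2) - 2 / a * Zt
      = R - a * (vt * w / (p - a) + wt * v / (p + a)) := by
    rw [hR]
    linear_combination p1
  have j2 : ξ + 2 * a * q / (a ^ 2 - q ^ 2) - 2 / a * Zh
      = R - a * (vh * w / (q - a) + wh * v / (q + a)) := by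
    rw [hR]
    linear_combination q1
  have j3 : ξ + 2 * a * p / (a ^ 2 - p ^ 2) + 2 * a * q / (a ^ 2 - q ^ 2) - 2 / a * Z₂
      = R - a * (vt * w / (p - a) + wt * v / (p + a))
        - a * (v₂ * wt / (q - a) + w₂ * vt / (q + a)) := by
    linear_combination j1 + r1
  have j4 : (p + a) / (p - a) * Vt + E = Xv + 2 * a * vt * v / (p - a) := by
    rw [hXv, p2]; ring
  have j5 : (q + a) / (q - a) * Vh + E = Xv + 2 * a * vh * v / (q - a) := by
    rw [hXv, q2]; ring
  have j6 : ((p + a) / (p - a))⁻¹ * Wt + F = Y - 2 * a * wt * w / (p + a) := by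
    rw [hY, inv_div, p3]; ring
  have j7 : ((q + a) / (q - a))⁻¹ * Wh + F = Y - 2 * a * wh * w / (q + a) := by
    rw [hY, inv_div, q3]; ring
  have j8 : (p + a) / (p - a) * ((q + a) / (q - a)) * V₂ + E = Xv + 2 * a * vt * v / (p - a)
      + 2 * a * ((p + a) / (p - a)) * v₂ * vt / (q - a) := by
    linear_combination j4 + (p + a) / (p - a) * r2
  have j9 : ((p + a) / (p - a) * ((q + a) / (q - a)))⁻¹ * W₂ + F = Y - 2 * a * wt * w / (p + a)
      - 2 * a * ((p - a) / (p + a)) * w₂ * wt / (q + a) := by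
    rw [inv_div] at j6
    rw [mul_inv, inv_div, inv_div]
    linear_combination j6 + (p - a) / (p + a) * r3
  rw [inv_one, one_mul, one_mul, ← hXv, ← hY, j1, j2, j3, j4, j5, j6, j7, j8, j9, i1, i2, i3]
  -- A = Q(α)/(p²-a²), G = Q(β)/(q²-a²), B = Q(α,β)/a².
  refine quad_of_increments (k := 2 * a / H)
    (A := -2 * R * vt * wt + Y * ((p + a) / (p - a)) * vt ^ 2 - Xv * ((p - a) / (p + a)) * wt ^ 2)
    (G := -2 * R * vh * wh + Y * ((q + a) / (q - a)) * vh ^ 2 - Xv * ((q - a) / (q + a)) * wh ^ 2)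
    (B := (-R * ((q - a) * (p + a) * vt * wh + (q + a) * (p - a) * wt * vh)
          + Y * (q + a) * (p + a) * vt * vh - Xv * (q - a) * (p - a) * wt * wh) / a ^ 2)
    ?_ ?_ ?_ ?_
  · field_simp
    ring
  · field_simp
    ring
  · field_simp
    ring
  · have hH' : H = ((p - a) * (q + a) * wt * vh - (p + a) * (q - a) * vt * wh) / (2 * a) := by
      field_simp
      linear_combination -hW
    rw [sq_sub_sq p, sq_sub_sq q]
    field_simp
    rw [hH']
    field_simp
    ring

end Relations

/-! ### The solution in tau form and its Q2 equation -/

section Solution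

open PowerSeries

variable {N : ℕ} {p q a b c : ℂ} (Ap Am : Matrix (Fin N) (Fin N) ℂ)

theorem hasDerivAt_nqcS (hp : p ≠ 0) (hq : q ≠ 0) (hc : c ≠ 0) (ha : a ≠ 0) (hb : b ≠ 0) {n m : ℤ}
    (hf : nqcF p q c Ap Am n m ≠ 0) :
    HasDerivAt (nqcS p q c Ap Am n m a)
      (-(1 / a * ((1 / b) ^ 2 * (miwaQuot N (waveSeries p q c n m) (1 / a)).eval (1 / b)
        + (1 / b) ^ 3 * (miwaQuot N (waveSeries p q c n m) (1 / a)).derivative.eval (1 / b)))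
        / tau N (waveSeries p q c n m)) b := by
  have h1 : HasDerivAt (fun b' : ℂ => 1 / b') (-(1 / b) ^ 2) b := by
    simpa using hasDerivAt_inv hb
  have h2 : HasDerivAt (fun b' : ℂ => (miwaQuot N (waveSeries p q c n m) (1 / a)).eval (1 / b'))
      ((miwaQuot N (waveSeries p q c n m) (1 / a)).derivative.eval (1 / b) * (-(1 / b) ^ 2)) b :=
    HasDerivAt.comp (h₂ := fun y => (miwaQuot N (waveSeries p q c n m) (1 / a)).eval y) b
      ((miwaQuot N (waveSeries p q c n m) (1 / a)).hasDerivAt (1 / b)) h1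
  have h3 := ((h1.const_mul (1 / a)).mul h2).div_const (tau N (waveSeries p q c n m))
  refine (h3.congr_of_eventuallyEq ?_).congr_deriv ?_
  · filter_upwards [continuousAt_id.eventually_ne hb] with b' hb'
    exact nqcS_eq Ap Am hp hq hc ha hb' hf
  · ring

theorem hasDerivAt_nqcS_plus (hp : p ≠ 0) (hq : q ≠ 0) (hc : c ≠ 0) (ha : a ≠ 0) {n m : ℤ}
    (hf : nqcF p q c Ap Am n m ≠ 0) :
    HasDerivAt (fun ε : ℂ => nqcS p q c Ap Am n m a (2 * a * ε - a))
      (-(1 / a * ((1 / a) ^ 2 * (miwaQuot N (waveSeries p q c n m) (1 / a)).eval (-(1 / a))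
        - (1 / a) ^ 3 * (miwaQuot N (waveSeries p q c n m) (1 / a)).derivative.eval (-(1 / a))))
        / tau N (waveSeries p q c n m) * (2 * a)) 0 := by
  have h1 : HasDerivAt (fun ε : ℂ => 2 * a * ε - a) (2 * a) 0 := by
    simpa using ((hasDerivAt_id (0 : ℂ)).const_mul (2 * a)).sub_const a
  have h2 := hasDerivAt_nqcS Ap Am hp hq hc ha (neg_ne_zero.2 ha) hf
  have h3 := HasDerivAt.scomp_of_eq (0 : ℂ) h2 h1 (by ring)
  refine HasDerivAt.congr_deriv (f := fun ε : ℂ => nqcS p q c Ap Am n m a (2 * a * ε - a)) h3 ?_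
  rw [div_neg, smul_eq_mul]
  ring

theorem hasDerivAt_nqcS_minus (hp : p ≠ 0) (hq : q ≠ 0) (hc : c ≠ 0) (ha : a ≠ 0) {n m : ℤ}
    (hf : nqcF p q c Ap Am n m ≠ 0) :
    HasDerivAt (fun ε : ℂ => nqcS p q c Ap Am n m (-a) (a - 2 * a * ε))
      (-(1 / a * ((1 / a) ^ 2 * (miwaQuot N (waveSeries p q c n m) (-(1 / a))).eval (1 / a)
        + (1 / a) ^ 3 * (miwaQuot N (waveSeries p q c n m) (-(1 / a))).derivative.eval (1 / a)))
        / tau N (waveSeries p q c n m) * (2 * a)) 0 := by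
  have h1 : HasDerivAt (fun ε : ℂ => a - 2 * a * ε) (-(2 * a)) 0 := by
    simpa using ((hasDerivAt_id (0 : ℂ)).const_mul (2 * a)).const_sub a
  have h2 := hasDerivAt_nqcS Ap Am hp hq hc (neg_ne_zero.2 ha) ha hf
  have h3 := HasDerivAt.scomp_of_eq (0 : ℂ) h2 h1 (by ring)
  refine HasDerivAt.congr_deriv (f := fun ε : ℂ => nqcS p q c Ap Am n m (-a) (a - 2 * a * ε)) h3 ?_
  rw [div_neg, smul_eq_mul]
  ring

theorem nqcUPlus_eq (hp : p ≠ 0) (hq : q ≠ 0) (hc : c ≠ 0) (ha : a ≠ 0) {n m : ℤ}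
    (hf : nqcF p q c Ap Am n m ≠ 0) :
    nqcUPlus p q c Ap Am n m a
      = ((1 / a) ^ 3 * (miwaQuot N (waveSeries p q c n m) (1 / a)).eval (-(1 / a))
        - (1 / a) ^ 4 * (miwaQuot N (waveSeries p q c n m) (1 / a)).derivative.eval (-(1 / a)))
        / tau N (waveSeries p q c n m) := by
  rw [nqcUPlus, (hasDerivAt_nqcS_plus Ap Am hp hq hc ha hf).deriv]
  have h : -(1 / (2 * a)) * (2 * a) = -1 := by field_simp
  linear_combination (-(1 / a * ((1 / a) ^ 2 *
    (miwaQuot N (waveSeries p q c n m) (1 / a)).eval (-(1 / a))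
      - (1 / a) ^ 3 * (miwaQuot N (waveSeries p q c n m) (1 / a)).derivative.eval (-(1 / a))))
        / tau N (waveSeries p q c n m)) * h

theorem nqcUMinus_eq (hp : p ≠ 0) (hq : q ≠ 0) (hc : c ≠ 0) (ha : a ≠ 0) {n m : ℤ}
    (hf : nqcF p q c Ap Am n m ≠ 0) :
    nqcUMinus p q c Ap Am n m a
      = -((1 / a) ^ 3 * (miwaQuot N (waveSeries p q c n m) (-(1 / a))).eval (1 / a)
        + (1 / a) ^ 4 * (miwaQuot N (waveSeries p q c n m) (-(1 / a))).derivative.eval (1 / a))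
        / tau N (waveSeries p q c n m) := by
  rw [nqcUMinus, (hasDerivAt_nqcS_minus Ap Am hp hq hc ha hf).deriv]
  have h : 1 / (2 * a) * (2 * a) = 1 := by field_simp
  linear_combination (-(1 / a * ((1 / a) ^ 2 *
    (miwaQuot N (waveSeries p q c n m) (-(1 / a))).eval (1 / a)
      + (1 / a) ^ 3 * (miwaQuot N (waveSeries p q c n m) (-(1 / a))).derivative.eval (1 / a)))
        / tau N (waveSeries p q c n m)) * h

theorem tau_ne_zero_of_nqcF (hp : p ≠ 0) (hq : q ≠ 0) (hc : c ≠ 0) {n m : ℤ}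
    (hf : nqcF p q c Ap Am n m ≠ 0) : tau N (waveSeries p q c n m) ≠ 0 := by
  rw [nqcF_eq_tau Ap Am hp hq hc] at hf
  exact right_ne_zero_of_mul hf

theorem nqcS_neg_self (hp : p ≠ 0) (hq : q ≠ 0) (hc : c ≠ 0) (ha : a ≠ 0) {n m : ℤ}
    (hf : nqcF p q c Ap Am n m ≠ 0) :
    nqcS p q c Ap Am n m (-a) a = -(1 / a) ^ 2 *
      (miwaQuot N (waveSeries p q c n m) (-(1 / a))).eval (1 / a)
        / tau N (waveSeries p q c n m) := by
  rw [nqcS_eq Ap Am hp hq hc (neg_ne_zero.2 ha) ha hf, div_neg]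
  ring

theorem one_sub_mul_nqcS (hp : p ≠ 0) (hq : q ≠ 0) (hc : c ≠ 0) (ha : a ≠ 0) {n m : ℤ}
    (hf : nqcF p q c Ap Am n m ≠ 0) :
    1 - 2 * a * nqcS p q c Ap Am n m a a = tauRatioSq N (waveSeries p q c n m) (1 / a) := by
  have ht := tau_ne_zero_of_nqcF Ap Am hp hq hc hf
  rw [nqcS_eq Ap Am hp hq hc ha ha hf, tauRatioSq, tau_mul_miwa]
  field_simp
  ring

theorem one_add_mul_nqcS (hp : p ≠ 0) (hq : q ≠ 0) (hc : c ≠ 0) (ha : a ≠ 0) {n m : ℤ}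
    (hf : nqcF p q c Ap Am n m ≠ 0) :
    1 + 2 * a * nqcS p q c Ap Am n m (-a) (-a)
      = tauRatioSq N (waveSeries p q c n m) (-(1 / a)) := by
  have h := one_sub_mul_nqcS Ap Am hp hq hc (neg_ne_zero.2 ha) hf
  rw [div_neg] at h
  rw [← h]
  ring

theorem latticeRho_neg (p q a : ℂ) (n m : ℤ) :
    latticeRho p q (-a) n m = (latticeRho p q a n m)⁻¹ := by
  simp only [latticeRho, sub_neg_eq_add, ← sub_eq_add_neg, mul_inv, ← inv_zpow, inv_div]

theorem latticeRho_ne_zero (hpa : p - a ≠ 0) (hpa' : p + a ≠ 0) (hqa : q - a ≠ 0)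
    (hqa' : q + a ≠ 0) (n m : ℤ) : latticeRho p q a n m ≠ 0 :=
  mul_ne_zero (zpow_ne_zero _ (div_ne_zero hpa' hpa)) (zpow_ne_zero _ (div_ne_zero hqa' hqa))

/-- The U-terms supply both the square of `quotRatio` and the product of the two `tauRatioSq`, and
these complete the expression to R² + XY. -/
theorem q2Sol_eq (hp : p ≠ 0) (hq : q ≠ 0) (hc : c ≠ 0) (ha : a ≠ 0) (hpa : p - a ≠ 0)
    (hpa' : p + a ≠ 0) (hqa : q - a ≠ 0) (hqa' : q + a ≠ 0) (ξ₀ A D : ℂ) {n m : ℤ}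
    (hf : nqcF p q c Ap Am n m ≠ 0) :
    q2Sol p q c Ap Am a ξ₀ A D n m = solForm N (waveSeries p q c n m) a
      (latticeXi p q a n m + ξ₀) (latticeRho p q a n m) (2 * D) (2 * A) := by
  have ht := tau_ne_zero_of_nqcF Ap Am hp hq hc hf
  have hx : (1 / a) ≠ 0 := one_div_ne_zero ha
  have hρ := latticeRho_ne_zero hpa hpa' hqa hqa' n m
  rw [q2Sol, one_sub_mul_nqcS Ap Am hp hq hc ha hf, one_add_mul_nqcS Ap Am hp hq hc ha hf,
    nqcS_neg_self Ap Am hp hq hc ha hf, nqcUPlus_eq Ap Am hp hq hc ha hf,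
    nqcUMinus_eq Ap Am hp hq hc ha hf, latticeRho_neg, solForm]
  have h1 := miwaQuot_derivative ht hx
  have h2 := miwaQuot_symm ht hx
  rw [quotRatio, h2]
  unfold tauRatioSq
  generalize tau N (waveSeries p q c n m * (miwa (1 / a) * miwa (1 / a))) = V at *
  generalize tau N (waveSeries p q c n m * (miwa (-(1 / a)) * miwa (-(1 / a)))) = W at *
  generalize tau N (waveSeries p q c n m) = t at *
  generalize (miwaQuot N (waveSeries p q c n m) (1 / a)).eval (-(1 / a)) = w at *
  generalize (miwaQuot N (waveSeries p q c n m) (1 / a)).derivative.eval (-(1 / a)) = d1 at *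
  generalize (miwaQuot N (waveSeries p q c n m) (-(1 / a))).derivative.eval (1 / a) = d2 at *
  generalize latticeRho p q a n m = r at *
  generalize latticeXi p q a n m = ξ at *
  have h3 : d2 = -(V * W - t ^ 2 + 4 * (1 / a) ^ 2 * w ^ 2) / (4 * (1 / a) ^ 2 * t) - d1 := by
    rw [← h1]
    field_simp
    ring
  rw [h3]
  field_simp
  ring

theorem waveSeries_succ_left (hp : p ≠ 0) (q c : ℂ) (n m : ℤ) :
    waveSeries p q c (n + 1) m = C p * (waveSeries p q c n m * miwa (-1 / p)) := by
  have h : C p * miwa (-1 / p) = C p + X := by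
    rw [miwa, mul_sub, ← mul_assoc, ← map_mul, mul_div_cancel₀ _ hp, mul_one, map_neg, map_one]
    ring
  rw [waveSeries, taylorSeries_zpow_succ hp, ← h, waveSeries]
  ring

theorem waveSeries_succ_right (hq : q ≠ 0) (p c : ℂ) (n m : ℤ) :
    waveSeries p q c n (m + 1) = C q * (waveSeries p q c n m * miwa (-1 / q)) := by
  have h : C q * miwa (-1 / q) = C q + X := by
    rw [miwa, mul_sub, ← mul_assoc, ← map_mul, mul_div_cancel₀ _ hq, mul_one, map_neg, map_one]
    ring
  rw [waveSeries, taylorSeries_zpow_succ hq, ← h, waveSeries]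
  ring

theorem tau_ne_zero_of_C_mul {d : ℂ} {g : ℂ⟦X⟧} (h : tau N (C d * g) ≠ 0) : tau N g ≠ 0 := by
  rw [tau_C_mul] at h
  exact right_ne_zero_of_mul h

theorem q2Sol_quad (hp : p ≠ 0) (hq : q ≠ 0) (hc : c ≠ 0) (ha : a ≠ 0) (hpa : p - a ≠ 0)
    (hpa' : p + a ≠ 0) (hqa : q - a ≠ 0) (hqa' : q + a ≠ 0) (ξ₀ A D : ℂ) {n m : ℤ}
    (h00 : nqcF p q c Ap Am n m ≠ 0) (h10 : nqcF p q c Ap Am (n + 1) m ≠ 0)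
    (h01 : nqcF p q c Ap Am n (m + 1) ≠ 0) (h11 : nqcF p q c Ap Am (n + 1) (m + 1) ≠ 0) :
    Q2Eq (a ^ 2 / (p ^ 2 - a ^ 2)) (a ^ 2 / (q ^ 2 - a ^ 2))
        (q2Sol p q c Ap Am a ξ₀ A D n m) (q2Sol p q c Ap Am a ξ₀ A D (n + 1) m)
        (q2Sol p q c Ap Am a ξ₀ A D n (m + 1)) (q2Sol p q c Ap Am a ξ₀ A D (n + 1) (m + 1)) := by
  have hρ := latticeRho_ne_zero hpa hpa' hqa hqa' n m
  have ep : (p + a) / (p - a) ≠ 0 := div_ne_zero hpa' hpa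
  have eq : (q + a) / (q - a) ≠ 0 := div_ne_zero hqa' hqa
  have t00 := tau_ne_zero_of_nqcF Ap Am hp hq hc h00
  have t10 := tau_ne_zero_of_nqcF Ap Am hp hq hc h10
  have t01 := tau_ne_zero_of_nqcF Ap Am hp hq hc h01
  have t11 := tau_ne_zero_of_nqcF Ap Am hp hq hc h11
  have ρ10 : latticeRho p q a (n + 1) m = (p + a) / (p - a) * latticeRho p q a n m := by
    rw [latticeRho, latticeRho, zpow_add_one₀ ep]
    ring
  have ρ01 : latticeRho p q a n (m + 1) = (q + a) / (q - a) * latticeRho p q a n m := by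
    rw [latticeRho, latticeRho, zpow_add_one₀ eq]
    ring
  have ρ11 : latticeRho p q a (n + 1) (m + 1)
      = (p + a) / (p - a) * ((q + a) / (q - a)) * latticeRho p q a n m := by
    rw [latticeRho, latticeRho, zpow_add_one₀ ep, zpow_add_one₀ eq]
    ring
  have ξ10 : latticeXi p q a (n + 1) m = latticeXi p q a n m + 2 * a * p / (a ^ 2 - p ^ 2) := by
    rw [latticeXi, latticeXi]
    push_cast
    ring
  have ξ01 : latticeXi p q a n (m + 1) = latticeXi p q a n m + 2 * a * q / (a ^ 2 - q ^ 2) := by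
    rw [latticeXi, latticeXi]
    push_cast
    ring
  have ξ11 : latticeXi p q a (n + 1) (m + 1) = latticeXi p q a n m
      + 2 * a * p / (a ^ 2 - p ^ 2) + 2 * a * q / (a ^ 2 - q ^ 2) := by
    rw [latticeXi, latticeXi]
    push_cast
    ring
  have g11 : waveSeries p q c (n + 1) (m + 1)
      = C (q * p) * (waveSeries p q c n m * miwa (-1 / p) * miwa (-1 / q)) := by
    rw [waveSeries_succ_right hq, waveSeries_succ_left hp, map_mul]
    ring
  rw [q2Sol_eq Ap Am hp hq hc ha hpa hpa' hqa hqa' ξ₀ A D h00,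
    q2Sol_eq Ap Am hp hq hc ha hpa hpa' hqa hqa' ξ₀ A D h10,
    q2Sol_eq Ap Am hp hq hc ha hpa hpa' hqa hqa' ξ₀ A D h01,
    q2Sol_eq Ap Am hp hq hc ha hpa hpa' hqa hqa' ξ₀ A D h11]
  -- For p = q the denominator H vanishes, but then ut = uh and the two lattice parameters agree, so
  -- Q2 is trivial.
  by_cases hpq : p = q
  · subst hpq
    have g : waveSeries p p c (n + 1) m = waveSeries p p c n (m + 1) := by
      rw [waveSeries_succ_left hp, waveSeries_succ_right hp]
    rw [g, ρ10, ρ01, ξ10, ξ01, Q2Eq]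
    ring
  · rw [waveSeries_succ_left hp] at t10
    rw [waveSeries_succ_right hq] at t01
    rw [g11] at t11
    have h := solForm_quad hp hq ha hpa hpa' hqa hqa' (sub_ne_zero.2 hpq) t00
      (tau_ne_zero_of_C_mul t10) (tau_ne_zero_of_C_mul t01) (tau_ne_zero_of_C_mul t11)
      (latticeXi p q a n m + ξ₀) (2 * D / latticeRho p q a n m) (2 * A * latticeRho p q a n m)
    rw [← solForm_mul _ hρ, ← solForm_mul _ hρ, ← solForm_mul _ hρ, ← solForm_mul _ hρ,
      one_mul] at h
    rw [g11, waveSeries_succ_left hp, waveSeries_succ_right hq, solForm_C_mul hp,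
      solForm_C_mul hq, solForm_C_mul (mul_ne_zero hq hp), ρ10, ρ01, ρ11, ξ10, ξ01, ξ11]
    convert h using 2 <;> ring

end Solution

/-! ### Degeneration from Q3 -/

section Degeneration

/-- Expansion to second order of the degenerating combination. -/
theorem tendsto_degeneration {a ξ₀ κ g l s₁ s₂ Z : ℂ} {E E' G L S₁ S₂ v : ℂ → ℂ}
    (hEE : ∀ᶠ ε in 𝓝[≠] (0 : ℂ), E ε * E' ε = 1) (hEG : ∀ᶠ ε in 𝓝[≠] (0 : ℂ), E ε ^ 2 = G ε)
    (hE : Tendsto E (𝓝[≠] 0) (𝓝 1)) (hG : HasDerivAt G (2 * g) 0) (hG0 : G 0 = 1)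
    (hL : Tendsto L (𝓝[≠] 0) (𝓝 l)) (hS₁ : HasDerivAt S₁ s₁ 0) (hS₂ : HasDerivAt S₂ s₂ 0)
    (hS₁0 : S₁ 0 = Z) (hS₂0 : S₂ 0 = Z)
    (hv : ∀ᶠ ε in 𝓝[≠] (0 : ℂ), L ε * ε
      + 1 / 2 * (1 / ε + 1 - ξ₀ + κ * ε) * E ε * (1 - 2 * a * ε * S₁ ε)
      + 1 / 2 * (1 / ε + 1 + ξ₀ + κ * ε) * E' ε * (1 + 2 * a * ε * S₂ ε)
      = 1 / ε + 1 + (1 + 2 * v ε) * ε) :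
    Tendsto v (𝓝[≠] 0) (𝓝 (1 / 2 * (-1 + l + 1 / 2 * (g ^ 2 + 2 * a * (s₂ - s₁ - 2 * g * Z))
      - ξ₀ * (g - 2 * a * Z) + κ))) := by
  have hne : ∀ᶠ ε in 𝓝[≠] (0 : ℂ), ε ≠ 0 := self_mem_nhdsWithin
  have hE' : Tendsto E' (𝓝[≠] 0) (𝓝 1) := by
    have h := hE.inv₀ one_ne_zero
    rw [inv_one] at h
    refine h.congr' ?_
    filter_upwards [hEE] with ε h
    exact (eq_inv_of_mul_eq_one_right h).symm
  -- (E - 1)/ε = ((G - 1)/ε)/(E + 1): the limit E → 1 selects the branch of the square root, so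
  -- differentiability of E is not presupposed.
  have he : Tendsto (fun ε => (E ε - 1) / ε) (𝓝[≠] 0) (𝓝 g) := by
    have h1 := hasDerivAt_iff_tendsto_slope.1 hG
    have h2 : Tendsto (fun ε => slope G 0 ε / (E ε + 1)) (𝓝[≠] 0) (𝓝 (2 * g / (1 + 1))) :=
      h1.div (hE.add_const 1) (by norm_num)
    rw [show 2 * g / (1 + 1) = g by ring] at h2
    refine h2.congr' ?_
    filter_upwards [hne, hEG, (hE.add_const 1).eventually_ne (by norm_num : (1 : ℂ) + 1 ≠ 0)]
      with ε h0 h3 h4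
    rw [slope_def_field, hG0, ← h3, sub_zero]
    field_simp
    ring
  have hS₁c : Tendsto S₁ (𝓝[≠] 0) (𝓝 Z) := by
    rw [← hS₁0]
    exact hS₁.continuousAt.tendsto.mono_left nhdsWithin_le_nhds
  have hS₂c : Tendsto S₂ (𝓝[≠] 0) (𝓝 Z) := by
    rw [← hS₂0]
    exact hS₂.continuousAt.tendsto.mono_left nhdsWithin_le_nhds
  have hd : Tendsto (fun ε => (S₂ ε - S₁ ε) / ε) (𝓝[≠] 0) (𝓝 (s₂ - s₁)) := by
    refine ((hasDerivAt_iff_tendsto_slope.1 hS₂).sub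
      (hasDerivAt_iff_tendsto_slope.1 hS₁)).congr' ?_
    filter_upwards [hne] with ε h0
    rw [slope_def_field, slope_def_field, hS₁0, hS₂0, sub_zero]
    field_simp
    ring
  have hid : Tendsto (fun ε : ℂ => ε) (𝓝[≠] 0) (𝓝 0) := tendsto_id.mono_left nhdsWithin_le_nhds
  -- An exact rewriting of v: the double pole is (E + 1/E - 2)/ε² = ((E-1)/ε)²/E, and S₁(0) = S₂(0)
  -- leaves only difference quotients of first order.
  have hlim : Tendsto (fun ε => 1 / 2 * (-1 + L ε
      + 1 / 2 * (((E ε - 1) / ε) ^ 2 * E' ε + 2 * a * ((S₂ ε - S₁ ε) / ε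
        - (E ε - 1) / ε * E' ε * S₂ ε - (E ε - 1) / ε * S₁ ε))
      + 1 / 2 * (1 - ξ₀) * ((E ε - 1) / ε - 2 * a * E ε * S₁ ε)
      + 1 / 2 * (1 + ξ₀) * (-((E ε - 1) / ε * E' ε) + 2 * a * E' ε * S₂ ε)
      + κ / 2 * (E ε * (1 - 2 * a * ε * S₁ ε) + E' ε * (1 + 2 * a * ε * S₂ ε)))) (𝓝[≠] 0)
      (𝓝 (1 / 2 * (-1 + l
      + 1 / 2 * (g ^ 2 * 1 + 2 * a * ((s₂ - s₁) - g * 1 * Z - g * Z))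
      + 1 / 2 * (1 - ξ₀) * (g - 2 * a * 1 * Z)
      + 1 / 2 * (1 + ξ₀) * (-(g * 1) + 2 * a * 1 * Z)
      + κ / 2 * (1 * (1 - 2 * a * 0 * Z) + 1 * (1 + 2 * a * 0 * Z))))) := by
    refine Tendsto.const_mul _ (((((hL.const_add _).add (Tendsto.const_mul _
      (((he.pow 2).mul hE').add (((hd.sub ((he.mul hE').mul hS₂c)).sub
        (he.mul hS₁c)).const_mul _)))).add ((he.sub ((hE.const_mul _).mul hS₁c)).const_mul _)).add
      (((he.mul hE').neg.add ((hE'.const_mul _).mul hS₂c)).const_mul _)).add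
      (Tendsto.const_mul _ ((hE.mul (((hid.const_mul _).mul hS₁c).const_sub _)).add
        (hE'.mul (((hid.const_mul _).mul hS₂c).const_add _)))))
  rw [show 1 / 2 * (-1 + l + 1 / 2 * (g ^ 2 + 2 * a * (s₂ - s₁ - 2 * g * Z))
      - ξ₀ * (g - 2 * a * Z) + κ) = (1 / 2 * (-1 + l
      + 1 / 2 * (g ^ 2 * 1 + 2 * a * ((s₂ - s₁) - g * 1 * Z - g * Z))
      + 1 / 2 * (1 - ξ₀) * (g - 2 * a * 1 * Z)
      + 1 / 2 * (1 + ξ₀) * (-(g * 1) + 2 * a * 1 * Z)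
      + κ / 2 * (1 * (1 - 2 * a * 0 * Z) + 1 * (1 + 2 * a * 0 * Z)))) by ring]
  refine hlim.congr' ?_
  filter_upwards [hne, hEE, hv] with ε h0 h1 h2
  have hE0 : E ε ≠ 0 := left_ne_zero_of_mul_eq_one h1
  have hEi : E' ε = (E ε)⁻¹ := eq_inv_of_mul_eq_one_right h1
  rw [hEi] at h2 ⊢
  have h3 : v ε = ((L ε * ε
      + 1 / 2 * (1 / ε + 1 - ξ₀ + κ * ε) * E ε * (1 - 2 * a * ε * S₁ ε)
      + 1 / 2 * (1 / ε + 1 + ξ₀ + κ * ε) * (E ε)⁻¹ * (1 + 2 * a * ε * S₂ ε)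
      - 1 / ε - 1) / ε - 1) / 2 := by
    rw [h2]
    field_simp
    ring
  rw [h3]
  field_simp
  ring

variable {p q a : ℂ}

theorem ratio_hasDerivAt (hpa : p - a ≠ 0) (hpa' : p + a ≠ 0) (n : ℤ) :
    HasDerivAt (fun ε : ℂ => ((p + a) * (p - a * (1 - 2 * ε))
      / ((p - a) * (p + a * (1 - 2 * ε)))) ^ n) (2 * (2 * a * (p / (p ^ 2 - a ^ 2) * n))) 0 := by
  have h1 : HasDerivAt (fun ε : ℂ => a * (1 - 2 * ε)) (-(2 * a)) 0 := by
    have := (((hasDerivAt_id (0 : ℂ)).const_mul 2).const_sub 1).const_mul a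
    refine this.congr_deriv ?_
    ring
  have h2 : (p - a) * (p + a * (1 - 2 * (0 : ℂ))) ≠ 0 := by
    simpa using ⟨hpa, hpa'⟩
  have h3 := ((h1.const_sub p).const_mul (p + a)).div ((h1.const_add p).const_mul (p - a)) h2
  have e : (p + a) * (p - a * (1 - 2 * (0 : ℂ))) / ((p - a) * (p + a * (1 - 2 * (0 : ℂ)))) = 1 := by
    rw [mul_zero, sub_zero, mul_one, mul_comm, div_self (mul_ne_zero hpa hpa')]
  have h4 := hasDerivAt_zpow n ((p + a) * (p - a * (1 - 2 * (0 : ℂ)))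
    / ((p - a) * (p + a * (1 - 2 * (0 : ℂ))))) (Or.inl (by rw [e]; exact one_ne_zero))
  refine (HasDerivAt.comp (h₂ := fun z : ℂ => z ^ n) (0 : ℂ) h4 h3).congr_deriv ?_
  rw [e, one_zpow, mul_one, sq_sub_sq, mul_zero, sub_zero, mul_one]
  field_simp
  ring

/-- P and Q enter only through their squares here, so their choice of sign is immaterial. -/
theorem q3Factor_mul_q3Factor {P Q b : ℂ} (hp : (p ^ 2 - a ^ 2) * (p ^ 2 - b ^ 2) ≠ 0)
    (hq : (q ^ 2 - a ^ 2) * (q ^ 2 - b ^ 2) ≠ 0)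
    (hP : P ^ 2 = (p ^ 2 - a ^ 2) * (p ^ 2 - b ^ 2))
    (hQ : Q ^ 2 = (q ^ 2 - a ^ 2) * (q ^ 2 - b ^ 2)) (n m : ℤ) :
    q3Factor p q P Q a (-b) n m * q3Factor p q P Q (-a) b n m = 1 := by
  have h : ∀ p P : ℂ, (p ^ 2 - a ^ 2) * (p ^ 2 - b ^ 2) ≠ 0 →
      P ^ 2 = (p ^ 2 - a ^ 2) * (p ^ 2 - b ^ 2) →
      P / ((p - a) * (p - -b)) * (P / ((p - -a) * (p - b))) = 1 := by
    intro p P h1 h2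
    rw [div_mul_div_comm, ← sq, h2, show (p - a) * (p - -b) * ((p - -a) * (p - b))
      = (p ^ 2 - a ^ 2) * (p ^ 2 - b ^ 2) by ring, div_self h1]
  rw [q3Factor, q3Factor, mul_mul_mul_comm, ← mul_zpow, ← mul_zpow, h p P hp hP, h q Q hq hQ,
    one_zpow, one_zpow, mul_one]

theorem q3Factor_sq {P Q b : ℂ} (hp : (p ^ 2 - a ^ 2) * (p ^ 2 - b ^ 2) ≠ 0)
    (hq : (q ^ 2 - a ^ 2) * (q ^ 2 - b ^ 2) ≠ 0)
    (hP : P ^ 2 = (p ^ 2 - a ^ 2) * (p ^ 2 - b ^ 2))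
    (hQ : Q ^ 2 = (q ^ 2 - a ^ 2) * (q ^ 2 - b ^ 2)) (n m : ℤ) :
    q3Factor p q P Q a (-b) n m ^ 2 = ((p + a) * (p - b) / ((p - a) * (p + b))) ^ n
      * ((q + a) * (q - b) / ((q - a) * (q + b))) ^ m := by
  have h : ∀ p P : ℂ, (p ^ 2 - a ^ 2) * (p ^ 2 - b ^ 2) ≠ 0 →
      P ^ 2 = (p ^ 2 - a ^ 2) * (p ^ 2 - b ^ 2) →
      P / ((p - a) * (p - -b)) * (P / ((p - a) * (p - -b)))
        = (p + a) * (p - b) / ((p - a) * (p + b)) := by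
    intro p P h1 h2
    rw [sq_sub_sq, sq_sub_sq] at h1
    have h3 := left_ne_zero_of_mul h1
    have h4 := right_ne_zero_of_mul h1
    have h5 := right_ne_zero_of_mul h3
    have h6 := left_ne_zero_of_mul h4
    rw [div_mul_div_comm, ← sq, h2, sub_neg_eq_add]
    field_simp
    ring
  rw [q3Factor, sq, mul_mul_mul_comm, ← mul_zpow, ← mul_zpow, h p P hp hP, h q Q hq hQ]

/-- Limits of the plane wave factors. -/
theorem tendsto_q3Factor {P Q b : ℂ → ℂ} {a' b' P₀ Q₀ : ℂ} {l : Filter ℂ}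
    (hP : Tendsto P l (𝓝 P₀)) (hQ : Tendsto Q l (𝓝 Q₀)) (hb : Tendsto b l (𝓝 b'))
    (hP₀ : P₀ ≠ 0) (hQ₀ : Q₀ ≠ 0) (hp : (p - a') * (p - b') ≠ 0) (hq : (q - a') * (q - b') ≠ 0)
    (n m : ℤ) :
    Tendsto (fun ε => q3Factor p q (P ε) (Q ε) a' (b ε) n m) l
      (𝓝 (q3Factor p q P₀ Q₀ a' b' n m)) := by
  unfold q3Factor
  exact ((hP.div ((hb.const_sub p).const_mul _) hp).zpow₀ n (Or.inl (div_ne_zero hP₀ hp))).mul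
    ((hQ.div ((hb.const_sub q).const_mul _) hq).zpow₀ m (Or.inl (div_ne_zero hQ₀ hq)))

-- With b = a(1-2ε) one has a - b = 2aε, so the B' and C' terms carry the poles, while the A' and D'
-- terms already have a factor ε and only need a limit.
open PowerSeries in
theorem tendsto_q2Sol {N : ℕ} {c : ℂ} (Ap Am : Matrix (Fin N) (Fin N) ℂ)
    (hp : p ≠ 0) (hq : q ≠ 0) (hc : c ≠ 0) (ha : a ≠ 0) (hpa : p - a ≠ 0)
    (hpa' : p + a ≠ 0) (hqa : q - a ≠ 0) (hqa' : q + a ≠ 0) (ξ₀ A D δ : ℂ) (hδ : δ ≠ 0)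
    {P Q v : ℂ → ℂ} {n m : ℤ}
    (hP : ∀ᶠ ε in 𝓝[≠] (0 : ℂ),
      P ε ^ 2 = (p ^ 2 - a ^ 2) * (p ^ 2 - (a * (1 - 2 * ε)) ^ 2))
    (hQ : ∀ᶠ ε in 𝓝[≠] (0 : ℂ),
      Q ε ^ 2 = (q ^ 2 - a ^ 2) * (q ^ 2 - (a * (1 - 2 * ε)) ^ 2))
    (hPt : Tendsto P (𝓝[≠] 0) (𝓝 (p ^ 2 - a ^ 2)))
    (hQt : Tendsto Q (𝓝[≠] 0) (𝓝 (q ^ 2 - a ^ 2)))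
    (hf : nqcF p q c Ap Am n m ≠ 0)
    (hv : ∀ᶠ ε in 𝓝[≠] (0 : ℂ),
        q3SolDegen p q c Ap Am (P ε) (Q ε) a ξ₀ A D δ ε n m
          = δ / (4 * a ^ 2) * (1 / ε + 1 + (1 + 2 * v ε) * ε)) :
    Tendsto v (𝓝[≠] 0) (𝓝 (q2Sol p q c Ap Am a ξ₀ A D n m)) := by
  have hp2 : p ^ 2 - a ^ 2 ≠ 0 := by
    rw [sq_sub_sq]
    exact mul_ne_zero hpa' hpa
  have hq2 : q ^ 2 - a ^ 2 ≠ 0 := by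
    rw [sq_sub_sq]
    exact mul_ne_zero hqa' hqa
  have hna : -a ≠ 0 := neg_ne_zero.2 ha
  have hb : Tendsto (fun ε : ℂ => a * (1 - 2 * ε)) (𝓝[≠] 0) (𝓝 a) := by
    have : ContinuousAt (fun ε : ℂ => a * (1 - 2 * ε)) 0 := by fun_prop
    have h := this.tendsto.mono_left (nhdsWithin_le_nhds (s := {0}ᶜ))
    simpa using h
  have hbn : Tendsto (fun ε : ℂ => -(a * (1 - 2 * ε))) (𝓝[≠] 0) (𝓝 (-a)) := hb.neg
  have hpb : ∀ᶠ ε in 𝓝[≠] (0 : ℂ), (p ^ 2 - a ^ 2) * (p ^ 2 - (a * (1 - 2 * ε)) ^ 2) ≠ 0 :=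
    (((hb.pow 2).const_sub _).const_mul _).eventually_ne (mul_ne_zero hp2 hp2)
  have hqb : ∀ᶠ ε in 𝓝[≠] (0 : ℂ), (q ^ 2 - a ^ 2) * (q ^ 2 - (a * (1 - 2 * ε)) ^ 2) ≠ 0 :=
    (((hb.pow 2).const_sub _).const_mul _).eventually_ne (mul_ne_zero hq2 hq2)
  have hE := tendsto_q3Factor (p := p) (q := q) (a' := a) hPt hQt hbn hp2 hq2
    (by rw [sub_neg_eq_add]; exact mul_ne_zero hpa hpa')
    (by rw [sub_neg_eq_add]; exact mul_ne_zero hqa hqa') n m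
  have hE1 : q3Factor p q (p ^ 2 - a ^ 2) (q ^ 2 - a ^ 2) a (-a) n m = 1 := by
    rw [q3Factor, show (p - a) * (p - -a) = p ^ 2 - a ^ 2 by ring,
      show (q - a) * (q - -a) = q ^ 2 - a ^ 2 by ring, div_self hp2, div_self hq2, one_zpow,
      one_zpow, mul_one]
  rw [hE1] at hE
  have hF1 := tendsto_q3Factor (p := p) (q := q) (a' := a) hPt hQt hb hp2 hq2
    (mul_ne_zero hpa hpa) (mul_ne_zero hqa hqa) n m
  have hF1' : q3Factor p q (p ^ 2 - a ^ 2) (q ^ 2 - a ^ 2) a a n m = latticeRho p q a n m := by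
    rw [q3Factor, latticeRho, sq_sub_sq, sq_sub_sq, mul_div_mul_right _ _ hpa,
      mul_div_mul_right _ _ hqa]
  rw [hF1'] at hF1
  have hF2 := tendsto_q3Factor (p := p) (q := q) (a' := -a) hPt hQt hbn hp2 hq2
    (by rw [sub_neg_eq_add]; exact mul_ne_zero hpa' hpa')
    (by rw [sub_neg_eq_add]; exact mul_ne_zero hqa' hqa') n m
  have hF2' : q3Factor p q (p ^ 2 - a ^ 2) (q ^ 2 - a ^ 2) (-a) (-a) n m
      = latticeRho p q (-a) n m := by
    rw [q3Factor, latticeRho, sq_sub_sq, sq_sub_sq, sub_neg_eq_add, sub_neg_eq_add,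
      mul_div_mul_left _ _ hpa', mul_div_mul_left _ _ hqa', ← sub_eq_add_neg, ← sub_eq_add_neg]
  rw [hF2'] at hF2
  have hS1 : Tendsto (fun ε : ℂ => nqcS p q c Ap Am n m a (a * (1 - 2 * ε))) (𝓝[≠] 0)
      (𝓝 (nqcS p q c Ap Am n m a a)) :=
    (hasDerivAt_nqcS Ap Am hp hq hc ha ha hf).continuousAt.tendsto.comp hb
  have hS2 : Tendsto (fun ε : ℂ => nqcS p q c Ap Am n m (-a) (-(a * (1 - 2 * ε)))) (𝓝[≠] 0)
      (𝓝 (nqcS p q c Ap Am n m (-a) (-a))) :=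
    (hasDerivAt_nqcS Ap Am hp hq hc hna hna hf).continuousAt.tendsto.comp hbn
  have hL : Tendsto (fun ε : ℂ => A * q3Factor p q (P ε) (Q ε) a (a * (1 - 2 * ε)) n m
        * (1 - (a + a * (1 - 2 * ε)) * nqcS p q c Ap Am n m a (a * (1 - 2 * ε)))
      + D * q3Factor p q (P ε) (Q ε) (-a) (-(a * (1 - 2 * ε))) n m
        * (1 + (a + a * (1 - 2 * ε)) * nqcS p q c Ap Am n m (-a) (-(a * (1 - 2 * ε)))))
      (𝓝[≠] 0) (𝓝 (A * latticeRho p q a n m * (1 - (a + a) * nqcS p q c Ap Am n m a a)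
        + D * latticeRho p q (-a) n m * (1 + (a + a) * nqcS p q c Ap Am n m (-a) (-a)))) :=
    ((hF1.const_mul A).mul (((hb.const_add a).mul hS1).const_sub 1)).add
      ((hF2.const_mul D).mul (((hb.const_add a).mul hS2).const_add 1))
  have hG := (ratio_hasDerivAt hpa hpa' n).mul (ratio_hasDerivAt hqa hqa' m)
  have hone : ∀ p : ℂ, p - a ≠ 0 → p + a ≠ 0 →
      (p + a) * (p - a * (1 - 2 * (0 : ℂ))) / ((p - a) * (p + a * (1 - 2 * (0 : ℂ)))) = 1 := by
    intro p h1 h2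
    rw [mul_zero, sub_zero, mul_one, mul_comm, div_self (mul_ne_zero h1 h2)]
  rw [hone p hpa hpa', hone q hqa hqa', one_zpow, one_zpow] at hG
  -- S(a,-a) = S(-a,a), from the symmetry of the quotient; without it a term of order 1/ε would
  -- remain in v.
  have hZ1 : nqcS p q c Ap Am n m a (2 * a * 0 - a) = nqcS p q c Ap Am n m (-a) a := by
    have ht := tau_ne_zero_of_nqcF Ap Am hp hq hc hf
    rw [show 2 * a * 0 - a = -a by ring, nqcS_neg_self Ap Am hp hq hc ha hf,
      nqcS_eq Ap Am hp hq hc ha hna hf, miwaQuot_symm ht (one_div_ne_zero ha), div_neg]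
    ring
  have hZ2 : nqcS p q c Ap Am n m (-a) (a - 2 * a * 0) = nqcS p q c Ap Am n m (-a) a := by
    rw [mul_zero, sub_zero]
  have hD1 := hasDerivAt_nqcS_plus Ap Am hp hq hc ha hf
  have hD2 := hasDerivAt_nqcS_minus Ap Am hp hq hc ha hf
  have hU1 := hD1.differentiableAt.hasDerivAt
  have hU2 := hD2.differentiableAt.hasDerivAt
  have key := tendsto_degeneration (a := a) (ξ₀ := ξ₀) (κ := (3 + ξ₀ ^ 2) / 2 + 2 * A * D)
    (g := -latticeXi p q a n m) (E := fun ε => q3Factor p q (P ε) (Q ε) a (-(a * (1 - 2 * ε))) n m)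
    (E' := fun ε => q3Factor p q (P ε) (Q ε) (-a) (a * (1 - 2 * ε)) n m) (v := v)
    (G := fun ε => ((p + a) * (p - a * (1 - 2 * ε)) / ((p - a) * (p + a * (1 - 2 * ε)))) ^ n
      * ((q + a) * (q - a * (1 - 2 * ε)) / ((q - a) * (q + a * (1 - 2 * ε)))) ^ m)
    (by
      filter_upwards [hP, hQ, hpb, hqb] with ε h1 h2 h3 h4
      exact q3Factor_mul_q3Factor h3 h4 h1 h2 n m)
    (by
      filter_upwards [hP, hQ, hpb, hqb] with ε h1 h2 h3 h4
      exact q3Factor_sq h3 h4 h1 h2 n m)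
    hE (hG.congr_deriv (by
      rw [latticeXi, ← neg_sub (p ^ 2), ← neg_sub (q ^ 2), div_neg, div_neg]
      ring))
    (by simp only [hone p hpa hpa', hone q hqa hqa', one_zpow, mul_one]) hL hU1 hU2 hZ1 hZ2
    (by
      filter_upwards [hv, self_mem_nhdsWithin] with ε h1 h0
      have h0 : ε ≠ 0 := h0
      rw [q3SolDegen, q3Sol] at h1
      have e1 : 2 * a * ε - a = -(a * (1 - 2 * ε)) := by ring
      have e2 : a - 2 * a * ε = a * (1 - 2 * ε) := by ring
      rw [e1, e2]
      have hd : δ / (4 * a ^ 2) ≠ 0 :=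
        div_ne_zero hδ (mul_ne_zero (by norm_num) (pow_ne_zero 2 ha))
      have e3 : δ / (8 * a ^ 2) = δ / (4 * a ^ 2) * (1 / 2) := by
        field_simp
        norm_num
      rw [e3] at h1
      apply mul_left_cancel₀ hd
      rw [← h1]
      ring)
  convert key using 2
  rw [q2Sol, nqcUPlus, nqcUMinus]
  have e : -(1 / (2 * a)) = -1 / (2 * a) := by ring
  field_simp
  ring

end Degeneration

/-! ### Polynomial dependence on (n, m) -/

section Rationality

open PowerSeries

/-- The series of `(1 + k / p) ^ ν`, where `ν` is the `i`-th variable. -/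
def binomialPolySeries (i : Fin 2) (p : ℂ) : (MvPolynomial (Fin 2) ℂ)⟦X⟧ :=
  PowerSeries.mk fun j => (∏ k ∈ Finset.range j, (MvPolynomial.X i - (k : MvPolynomial (Fin 2) ℂ)))
    * MvPolynomial.C (p ^ (-(j : ℤ)) / j.factorial)

/-- The series `waveSeries p q c n m / (p ^ n q ^ m)`, with coefficients polynomial in `n`, `m`. -/
def wavePolySeries (p q c : ℂ) : (MvPolynomial (Fin 2) ℂ)⟦X⟧ :=
  binomialPolySeries 0 p * binomialPolySeries 1 q
    * PowerSeries.map MvPolynomial.C (taylorSeries (halfPow c 0))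

theorem taylorSeries_zpow_eq_map {p : ℂ} (hp : p ≠ 0) (i : Fin 2) (ν : Fin 2 → ℂ) (n : ℤ)
    (hn : ν i = n) :
    taylorSeries (fun k => (p + k) ^ n)
      = C (p ^ n) * PowerSeries.map (MvPolynomial.eval ν) (binomialPolySeries i p) := by
  ext j
  rw [coeff_taylorSeries_zpow, coeff_C_mul, coeff_map, binomialPolySeries, coeff_mk, map_mul,
    map_prod, MvPolynomial.eval_C]
  simp only [map_sub, MvPolynomial.eval_X, map_natCast, hn]
  rw [sub_eq_add_neg, zpow_add₀ hp]
  ring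

/-- All exponential dependence on n, m sits in a constant factor, which contributes an N-th power to
`tau` and to `miwaQuot` and hence drops out of their ratios. -/
theorem waveSeries_eq_map {p q : ℂ} (hp : p ≠ 0) (hq : q ≠ 0) (c : ℂ) (n m : ℤ) :
    waveSeries p q c n m = C (p ^ n * q ^ m)
      * PowerSeries.map (MvPolynomial.eval ![(n : ℂ), (m : ℂ)]) (wavePolySeries p q c) := by
  have h : PowerSeries.map (MvPolynomial.eval ![(n : ℂ), (m : ℂ)])
      (PowerSeries.map MvPolynomial.C (taylorSeries (halfPow c 0)))
      = taylorSeries (halfPow c 0) := by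
    ext k
    simp
  rw [waveSeries, taylorSeries_zpow_eq_map hp 0 ![(n : ℂ), (m : ℂ)] n rfl,
    taylorSeries_zpow_eq_map hq 1 ![(n : ℂ), (m : ℂ)] m rfl, wavePolySeries, map_mul, map_mul,
    map_mul, h]
  ring

theorem eval_miwaQuot_map {N : ℕ} (ν : Fin 2 → ℂ) (g : (MvPolynomial (Fin 2) ℂ)⟦X⟧) (x y : ℂ) :
    (miwaQuot N (PowerSeries.map (MvPolynomial.eval ν) g) x).eval y
      = MvPolynomial.eval ν ((miwaQuot N g (MvPolynomial.C x)).eval (MvPolynomial.C y)) := by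
  rw [← Polynomial.eval_map_apply, map_miwaQuot, MvPolynomial.eval_C, MvPolynomial.eval_C]

theorem eval_derivative_miwaQuot_map {N : ℕ} (ν : Fin 2 → ℂ) (g : (MvPolynomial (Fin 2) ℂ)⟦X⟧)
    (x y : ℂ) :
    (miwaQuot N (PowerSeries.map (MvPolynomial.eval ν) g) x).derivative.eval y
      = MvPolynomial.eval ν
        ((miwaQuot N g (MvPolynomial.C x)).derivative.eval (MvPolynomial.C y)) := by
  rw [← Polynomial.eval_map_apply, ← Polynomial.derivative_map, map_miwaQuot, MvPolynomial.eval_C,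
    MvPolynomial.eval_C]

theorem tau_miwa_map {N : ℕ} (ν : Fin 2 → ℂ) (g : (MvPolynomial (Fin 2) ℂ)⟦X⟧) (x y : ℂ) :
    tau N (PowerSeries.map (MvPolynomial.eval ν) g * (miwa x * miwa y))
      = MvPolynomial.eval ν
        (tau N (g * (miwa (MvPolynomial.C x) * miwa (MvPolynomial.C y)))) := by
  rw [tau_map, map_mul, map_mul, map_miwa, map_miwa, MvPolynomial.eval_C, MvPolynomial.eval_C]

variable {N : ℕ} {p q a c : ℂ} (Ap Am : Matrix (Fin N) (Fin N) ℂ)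

theorem q2Sol_rational (hp : p ≠ 0) (hq : q ≠ 0) (hc : c ≠ 0) (ha : a ≠ 0) (ξ₀ A D : ℂ) :
    ∃ F G₀ G₁ G₂ : MvPolynomial (Fin 2) ℂ,
      (∀ n m : ℤ, nqcF p q c Ap Am n m
        = (p ^ n * q ^ m) ^ N * MvPolynomial.eval ![(n : ℂ), (m : ℂ)] F) ∧
      ∀ n m : ℤ, nqcF p q c Ap Am n m ≠ 0 →
        q2Sol p q c Ap Am a ξ₀ A D n m
          = (MvPolynomial.eval ![(n : ℂ), (m : ℂ)] G₀
              + A * latticeRho p q a n m * MvPolynomial.eval ![(n : ℂ), (m : ℂ)] G₁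
              + D * latticeRho p q (-a) n m * MvPolynomial.eval ![(n : ℂ), (m : ℂ)] G₂)
            / MvPolynomial.eval ![(n : ℂ), (m : ℂ)] F := by
  set g := wavePolySeries p q c with hg
  set x := MvPolynomial.C (σ := Fin 2) (1 / a) with hx
  set y := MvPolynomial.C (σ := Fin 2) (-(1 / a)) with hy
  set δ := MvPolynomial.C (σ := Fin 2) (Ap + Am).det with hδ
  set Ξ := MvPolynomial.C (2 * a * (p / (a ^ 2 - p ^ 2))) * MvPolynomial.X (0 : Fin 2)
    + MvPolynomial.C (2 * a * (q / (a ^ 2 - q ^ 2))) * MvPolynomial.X (1 : Fin 2)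
    + MvPolynomial.C ξ₀ with hΞ
  have hF : ∀ n m : ℤ, nqcF p q c Ap Am n m
        = (p ^ n * q ^ m) ^ N * MvPolynomial.eval ![(n : ℂ), (m : ℂ)] (δ * tau N g) := by
    intro n m
    rw [nqcF_eq_tau Ap Am hp hq hc, waveSeries_eq_map hp hq, tau_C_mul, ← tau_map, map_mul,
      MvPolynomial.eval_C]
    ring
  -- The numerators are those of S(-a,a), U(±a,∓a) and `tauRatioSq` over the common denominator `tau
  -- N g`, multiplied by `(Ap + Am).det` to match F.
  refine ⟨δ * tau N g,
    δ * ((MvPolynomial.C (1 / 4) * (Ξ ^ 2 + 1) + MvPolynomial.C (A * D)) * tau N g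
      - MvPolynomial.C a * Ξ * x ^ 2 * (miwaQuot N g y).eval x
      + MvPolynomial.C (a ^ 2) * (x ^ 3 * (miwaQuot N g x).eval y
        - x ^ 4 * (miwaQuot N g x).derivative.eval y
        - x ^ 3 * (miwaQuot N g y).eval x - x ^ 4 * (miwaQuot N g y).derivative.eval x)),
    δ * MvPolynomial.C (1 / 2) * tau N (g * (miwa x * miwa x)),
    δ * MvPolynomial.C (1 / 2) * tau N (g * (miwa y * miwa y)), hF, ?_⟩
  intro n m hf
  have hd : (p ^ n * q ^ m) ^ N ≠ 0 :=
    pow_ne_zero _ (mul_ne_zero (zpow_ne_zero _ hp) (zpow_ne_zero _ hq))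
  have hf' := hf
  rw [hF, map_mul, hδ, MvPolynomial.eval_C] at hf'
  have hdet := left_ne_zero_of_mul (right_ne_zero_of_mul hf')
  have ht := right_ne_zero_of_mul (right_ne_zero_of_mul hf')
  rw [q2Sol, one_sub_mul_nqcS Ap Am hp hq hc ha hf, one_add_mul_nqcS Ap Am hp hq hc ha hf,
    nqcS_neg_self Ap Am hp hq hc ha hf, nqcUPlus_eq Ap Am hp hq hc ha hf,
    nqcUMinus_eq Ap Am hp hq hc ha hf, tauRatioSq, tauRatioSq, waveSeries_eq_map hp hq,
    miwaQuot_C_mul, miwaQuot_C_mul, mul_assoc (C (p ^ n * q ^ m)), mul_assoc (C (p ^ n * q ^ m)),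
    tau_C_mul, tau_C_mul, tau_C_mul, tau_miwa_map, tau_miwa_map, ← tau_map]
  simp only [Polynomial.derivative_C_mul, Polynomial.eval_mul, Polynomial.eval_C,
    eval_miwaQuot_map, eval_derivative_miwaQuot_map]
  have hξ : MvPolynomial.eval ![(n : ℂ), (m : ℂ)] Ξ = latticeXi p q a n m + ξ₀ := by
    simp only [hΞ, map_add, map_mul, MvPolynomial.eval_C, MvPolynomial.eval_X, latticeXi]
    simp
    ring
  simp only [← hg, ← hx, ← hy]
  have hx' : MvPolynomial.eval ![(n : ℂ), (m : ℂ)] x = 1 / a := MvPolynomial.eval_C _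
  have hδ' : MvPolynomial.eval ![(n : ℂ), (m : ℂ)] δ = (Ap + Am).det := MvPolynomial.eval_C _
  simp only [map_add, map_sub, map_mul, map_pow, map_one, MvPolynomial.eval_C, hξ, hx', hδ']
  generalize (Ap + Am).det = δ' at *
  generalize (p ^ n * q ^ m) ^ N = d at *
  field_simp
  ring

end Rationality

end

theorem mainTheorem5 {N : ℕ} (p q a c : ℂ) (Ap Am : Matrix (Fin N) (Fin N) ℂ)
    (hp : p ≠ 0) (hq : q ≠ 0) (ha : a ≠ 0) (hc : c ≠ 0)
    (hpa : p ^ 2 ≠ a ^ 2) (hqa : q ^ 2 ≠ a ^ 2)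
    (hAp : IsLowerToeplitz Ap) (hAm : IsLowerToeplitz Am)
    (hApU : IsUnit Ap.det) (hAmU : IsUnit Am.det)
    (ξ₀ A D : ℂ) :
    -- the derivatives defining `U(a,-a)` and `U(-a,a)` exist
    (∀ n m : ℤ, nqcF p q c Ap Am n m ≠ 0 →
      DifferentiableAt ℂ (fun ε : ℂ => nqcS p q c Ap Am n m a (2 * a * ε - a)) 0 ∧
      DifferentiableAt ℂ (fun ε : ℂ => nqcS p q c Ap Am n m (-a) (a - 2 * a * ε)) 0) ∧
    -- degeneration: if the substituted Q3 solution is written as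
    -- `δ / (4a²) * (1 / ε + 1 + (1 + 2 v(ε)) ε)`, then `v(ε)` tends to `u` as `ε → 0`
    (∀ (δ : ℂ) (P Q v : ℂ → ℂ) (n m : ℤ), δ ≠ 0 →
      (∀ᶠ ε in 𝓝[≠] (0 : ℂ),
        P ε ^ 2 = (p ^ 2 - a ^ 2) * (p ^ 2 - (a * (1 - 2 * ε)) ^ 2)) →
      (∀ᶠ ε in 𝓝[≠] (0 : ℂ),
        Q ε ^ 2 = (q ^ 2 - a ^ 2) * (q ^ 2 - (a * (1 - 2 * ε)) ^ 2)) →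
      Tendsto P (𝓝[≠] 0) (𝓝 (p ^ 2 - a ^ 2)) →
      Tendsto Q (𝓝[≠] 0) (𝓝 (q ^ 2 - a ^ 2)) →
      nqcF p q c Ap Am n m ≠ 0 →
      (∀ᶠ ε in 𝓝[≠] (0 : ℂ),
        q3SolDegen p q c Ap Am (P ε) (Q ε) a ξ₀ A D δ ε n m
          = δ / (4 * a ^ 2) * (1 / ε + 1 + (1 + 2 * v ε) * ε)) →
      Tendsto v (𝓝[≠] 0) (𝓝 (q2Sol p q c Ap Am a ξ₀ A D n m))) ∧
    -- `u` is a rational function of `(n, m)`, up to the factors `ρ(±a)` that come with `A`, `D`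
    (∃ F G₀ G₁ G₂ : MvPolynomial (Fin 2) ℂ,
      (∀ n m : ℤ, nqcF p q c Ap Am n m
        = (p ^ n * q ^ m) ^ N * MvPolynomial.eval ![(n : ℂ), (m : ℂ)] F) ∧
      ∀ n m : ℤ, nqcF p q c Ap Am n m ≠ 0 →
        q2Sol p q c Ap Am a ξ₀ A D n m
          = (MvPolynomial.eval ![(n : ℂ), (m : ℂ)] G₀
              + A * latticeRho p q a n m * MvPolynomial.eval ![(n : ℂ), (m : ℂ)] G₁
              + D * latticeRho p q (-a) n m * MvPolynomial.eval ![(n : ℂ), (m : ℂ)] G₂)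
            / MvPolynomial.eval ![(n : ℂ), (m : ℂ)] F) ∧
    -- `u` solves Q2 (in the original and in the re-parametrized form) wherever it is defined
    (∀ n m : ℤ, nqcF p q c Ap Am n m ≠ 0 → nqcF p q c Ap Am (n + 1) m ≠ 0 →
      nqcF p q c Ap Am n (m + 1) ≠ 0 → nqcF p q c Ap Am (n + 1) (m + 1) ≠ 0 →
      Q2Eq (a ^ 2 / (p ^ 2 - a ^ 2)) (a ^ 2 / (q ^ 2 - a ^ 2))
        (q2Sol p q c Ap Am a ξ₀ A D n m) (q2Sol p q c Ap Am a ξ₀ A D (n + 1) m)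
        (q2Sol p q c Ap Am a ξ₀ A D n (m + 1)) (q2Sol p q c Ap Am a ξ₀ A D (n + 1) (m + 1)) ∧
      Q2ParamEq p q a
        ((p ^ 2 - a ^ 2) ^ 2 * (q ^ 2 - a ^ 2) ^ 2 / a ^ 4 * q2Sol p q c Ap Am a ξ₀ A D n m)
        ((p ^ 2 - a ^ 2) ^ 2 * (q ^ 2 - a ^ 2) ^ 2 / a ^ 4
          * q2Sol p q c Ap Am a ξ₀ A D (n + 1) m)
        ((p ^ 2 - a ^ 2) ^ 2 * (q ^ 2 - a ^ 2) ^ 2 / a ^ 4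
          * q2Sol p q c Ap Am a ξ₀ A D n (m + 1))
        ((p ^ 2 - a ^ 2) ^ 2 * (q ^ 2 - a ^ 2) ^ 2 / a ^ 4
          * q2Sol p q c Ap Am a ξ₀ A D (n + 1) (m + 1))) := by
  have hp2 : p ^ 2 - a ^ 2 ≠ 0 := sub_ne_zero.2 hpa
  have hq2 : q ^ 2 - a ^ 2 ≠ 0 := sub_ne_zero.2 hqa
  have hp3 := hp2
  have hq3 := hq2
  rw [sq_sub_sq] at hp3 hq3
  have p1 := right_ne_zero_of_mul hp3
  have p2 := left_ne_zero_of_mul hp3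
  have q1 := right_ne_zero_of_mul hq3
  have q2 := left_ne_zero_of_mul hq3
  refine ⟨fun n m hf => ⟨(hasDerivAt_nqcS_plus Ap Am hp hq hc ha hf).differentiableAt,
    (hasDerivAt_nqcS_minus Ap Am hp hq hc ha hf).differentiableAt⟩, ?_,
    q2Sol_rational Ap Am hp hq hc ha ξ₀ A D, ?_⟩
  · intro δ P Q v n m hδ hP hQ hPt hQt hf hv
    exact tendsto_q2Sol Ap Am hp hq hc ha p1 p2 q1 q2 ξ₀ A D δ hδ hP hQ hPt hQt hf hv
  · intro n m h00 h10 h01 h11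
    have h := q2Sol_quad Ap Am hp hq hc ha p1 p2 q1 q2 ξ₀ A D h00 h10 h01 h11
    exact ⟨h, q2Param_of_q2 ha hp2 hq2 h⟩
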